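/- **Model.** A network has $K\ge 1$ vehicle pairs $S_i\to D_i$ at positions $\mathbf x_{S,i},\mathbf x_{D,i}\in\mathbb R^2$ and a roadside unit (RSU) at $\mathbf x_R\in\mathbb R^2$, with $\mathbf x_{S,i}\ne\mathbf x_{D,i}$, $\mathbf x_{S,i}\neq\mathbf x_R\ne\mathbf x_{D,i}$; powers $P_s,P_r>0$, noise power $N_0>0$, path loss exponents $\alpha_1,\alpha_2$, sending probability $p_0\in(0,1)$, and durations $\delta,\tau_R,\tau_C>0$ and $\tau_d>\tau_1:=\tau_R+\tau_C$. Put $\tau_{d,1}:=\tau_d-\tau_1$. The process runs in independent, identically distributed rounds $k=1,2,\dots$. In the slots of round $k$ each source independently sends a request with probability $p_0$. A slot is idle (no sender; duration $\delta$), a collision (at least two senders; duration $\tau_R$) or successful (exactly one sender; duration $\tau_R+\tau_C$); the contention of round $k$ ends with its first successful slot, whose sender $w(k)$ is the winner, and $t_w(k)$ is the total duration of the slots of this contention. Independently of the slots, the signal-to-noise ratios (SNRs) $\gamma_i(k),\gamma_{1,i}(k),\gamma_{2,i}(k)$ $(1\le i\le K)$ are independent exponential variables with means $P_s\|\mathbf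 x_{S,i}-\mathbf x_{D,i}\|^{-\alpha_1}/N_0$, $P_s\|\mathbf x_{S,i}-\mathbf x_R\|^{-\alpha_2}/N_0$, $P_r\|\mathbf x_R-\mathbf x_{D,i}\|^{-\alpha_2}/N_0$. With $w=w(k)$ put $$R_{d,k}=\log_2(1+\gamma_w(k)),\qquad R_{r,k}=\tfrac12\log_2\Big(1+\gamma_w(k)+\frac{\gamma_{1,w}(k)\gamma_{2,w}(k)}{\gamma_{1,w}(k)+\gamma_{2,w}(k)+1}\Big).$$ After the contention of round $k$ the triple $(t_w(k),w(k),\gamma_{w(k)}(k))$ is observed, and one decides to stop (transmit over the direct vehicle-to-vehicle (V2V) link), to re-contend (go to round $k+1$), or to probe the RSU; in the last case $(\gamma_{1,w(k)}(k),\gamma_{2,w(k)}(k))$ is observed too, and one decides to stop or to re-contend. A strategy lets every decision be a measurable function of everything observed so far; it is feasible if it almost surely stops and its time cost $T$ has finite mean. If it stops in round $k$, then $Y=\tau_dR_{d,k}$ if it stops without probing in round $k$, and $Y=\tau_{d,1}\max\{R_{d,k},R_{r,k}\}$ if it stops after probing in round $k$, and $$T=\sum_{l=1}^{k}t_w(l)+\tau_1\cdot\#\{l<k:\text{the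 RSU was probed in round }l\}+\tau_d .$$ The throughput of the strategy is $\mathbb E[Y]/\mathbb E[T]$. For $\lambda\in\mathbb R$ and $\gamma\ge 0$ let $$W_i(\gamma,\lambda)=\mathbb E\big[\max\{\tau_{d,1}\max\{R_{d,k},R_{r,k}\}-\lambda\tau_d,\,-\lambda\tau_1\}\,\big|\,w(k)=i,\ \gamma_i(k)=\gamma\big],$$ and, with $q=Kp_0(1-p_0)^{K-1}$, let $$\tau_o=\tau_R+\tau_C+\frac{(1-p_0)^K\delta}{q}+\frac{(1-(1-p_0)^K-q)\,\tau_R}{q}.$$ **Theorem.** There is a number $\lambda^*>0$ that is the maximum of $\mathbb E[Y]/\mathbb E[T]$ over all feasible strategies ($Y$ being integrable for each of them). It is the unique real solution $\lambda$ of $$\mathbb E\big[\max\{\tau_dR_{d,k}-\lambda\tau_d,\ 0,\ W_{w(k)}(\gamma_{w(k)}(k),\lambda)\}\big]=\lambda\tau_o .$$ The maximum is attained by the following strategy, the RSU probing and cooperative access (RPCA) strategy, which is feasible. In round $k=1,2,\dots$, until it stops: 1. After the first observation: if $\tau_dR_{d,k}-\lambda^*\tau_d\ge\max\{W_{w(k)}(\gamma_{w(k)}(k),\lambda^*),0\}$,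 stop and transmit over the V2V link; if $\tau_dR_{d,k}-\lambda^*\tau_d<0$ and $W_{w(k)}(\gamma_{w(k)}(k),\lambda^*)<0$, re-contend; otherwise probe the RSU. 2. After probing: stop if $\max\{R_{d,k},R_{r,k}\}\ge\lambda^*$; otherwise re-contend. All expectations that occur here are those of integrable random variables. -/

import Mathlib

open MeasureTheory ProbabilityTheory Filter

namespace VANET

noncomputable section

/-- Parameters of the network with `K` vehicle pairs `S_i - D_i` and one roadside unit (RSU). -/
structure Network (K : ℕ) where
  /-- locations of the sources -/
  xS : Fin K → EuclideanSpace ℝ (Fin 2)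
  /-- locations of the destinations -/
  xD : Fin K → EuclideanSpace ℝ (Fin 2)
  /-- location of the RSU -/
  xR : EuclideanSpace ℝ (Fin 2)
  /-- transmission power of the sources -/
  Ps : ℝ
  /-- transmission power of the RSU -/
  Pr : ℝ
  /-- noise power -/
  N0 : ℝ
  /-- path loss exponent of the V2V links -/
  α₁ : ℝ
  /-- path loss exponent of the links between vehicles and the RSU -/
  α₂ : ℝ
  /-- probability with which a source sends an RTS in a contention slot -/
  p0 : ℝ
  /-- duration of an idle slot -/
  δ : ℝ
  /-- duration of an RTS -/
  τR : ℝ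
  /-- duration of a CTS -/
  τC : ℝ
  /-- maximal transmission duration -/
  τd : ℝ
  xS_ne_xD : ∀ i, xS i ≠ xD i
  xS_ne_xR : ∀ i, xS i ≠ xR
  xR_ne_xD : ∀ i, xR ≠ xD i
  Ps_pos : 0 < Ps
  Pr_pos : 0 < Pr
  N0_pos : 0 < N0
  p0_pos : 0 < p0
  p0_lt_one : p0 < 1
  δ_pos : 0 < δ
  τR_pos : 0 < τR
  τC_pos : 0 < τC
  /-- probing the RSU leaves a positive time for the data transmission -/
  probe_lt : τR + τC < τd

variable {K : ℕ}

namespace Network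

/-- Duration of RSU probing. -/
def τ₁ (N : Network K) : ℝ := N.τR + N.τC

/-- Duration of the data transmission after RSU probing. -/
def τd₁ (N : Network K) : ℝ := N.τd - N.τ₁

/-- Probability that a contention slot is successful. -/
def pSucc (N : Network K) : ℝ := K * N.p0 * (1 - N.p0) ^ (K - 1)

/-- Mean duration of the observation consisting of a whole channel contention. -/
def τo (N : Network K) : ℝ :=
  N.τR + N.τC + (1 - N.p0) ^ K * N.δ / N.pSucc
    + (1 - (1 - N.p0) ^ K - N.pSucc) * N.τR / N.pSucc

/-- Mean SNR of the link `S_i → D_i`. -/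
def meanSNR (N : Network K) (i : Fin K) : ℝ := N.Ps * ‖N.xS i - N.xD i‖ ^ (-N.α₁) / N.N0

/-- Mean SNR of the link `S_i → RSU`. -/
def meanSNR₁ (N : Network K) (i : Fin K) : ℝ := N.Ps * ‖N.xS i - N.xR‖ ^ (-N.α₂) / N.N0

/-- Mean SNR of the link `RSU → D_i`. -/
def meanSNR₂ (N : Network K) (i : Fin K) : ℝ := N.Pr * ‖N.xR - N.xD i‖ ^ (-N.α₂) / N.N0

end Network

/-! ### One round: a channel contention and the SNRs valid after it -/

/-- Outcome of a contention slot: which sources send an RTS. -/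
abbrev Slot (K : ℕ) : Type := Fin K → Bool

/-- The randomness of one round: the contention slots `0, 1, 2, …` (only those up to the first
successful one are used) and, for each pair `i`, the SNRs `(γ_i, γ_{1,i}, γ_{2,i})`. -/
abbrev Round (K : ℕ) : Type := (ℕ → Slot K) × (Fin K → ℝ × ℝ × ℝ)

/-- Law of one contention slot: the sources send independently with probability `p0`. -/
def slotLaw (N : Network K) : Measure (Slot K) :=
  Measure.pi fun _ => bernoulliMeasure true false ⟨N.p0, N.p0_pos.le, N.p0_lt_one.le⟩

/-- Law of the SNRs `(γ_{1,i}, γ_{2,i})` of the two links via the RSU: independent exponentials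
(`expMeasure` is parametrized by the inverse of the mean). -/
def rsuLaw (N : Network K) (i : Fin K) : Measure (ℝ × ℝ) :=
  (expMeasure (N.meanSNR₁ i)⁻¹).prod (expMeasure (N.meanSNR₂ i)⁻¹)

/-- Law of `(γ_i, γ_{1,i}, γ_{2,i})`. -/
def snrLaw (N : Network K) (i : Fin K) : Measure (ℝ × ℝ × ℝ) :=
  (expMeasure (N.meanSNR i)⁻¹).prod (rsuLaw N i)

/-- Law of one round; slots and SNRs are all independent. -/
def roundLaw (N : Network K) : Measure (Round K) :=
  (Measure.infinitePi fun _ : ℕ => slotLaw N).prod (Measure.pi fun i => snrLaw N i)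

/-- The sample space: an infinite sequence of rounds. -/
abbrev Path (K : ℕ) : Type := ℕ → Round K

/-- The rounds are independent and identically distributed. -/
def pathLaw (N : Network K) : Measure (Path K) :=
  Measure.infinitePi fun _ : ℕ => roundLaw N

lemma Network.meanSNR_pos (N : Network K) (i : Fin K) : 0 < N.meanSNR i :=
  div_pos (mul_pos N.Ps_pos (Real.rpow_pos_of_pos
    (norm_pos_iff.2 (sub_ne_zero.2 (N.xS_ne_xD i))) _)) N.N0_pos

lemma Network.meanSNR₁_pos (N : Network K) (i : Fin K) : 0 < N.meanSNR₁ i :=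
  div_pos (mul_pos N.Ps_pos (Real.rpow_pos_of_pos
    (norm_pos_iff.2 (sub_ne_zero.2 (N.xS_ne_xR i))) _)) N.N0_pos

lemma Network.meanSNR₂_pos (N : Network K) (i : Fin K) : 0 < N.meanSNR₂ i :=
  div_pos (mul_pos N.Pr_pos (Real.rpow_pos_of_pos
    (norm_pos_iff.2 (sub_ne_zero.2 (N.xR_ne_xD i))) _)) N.N0_pos

instance (N : Network K) : IsProbabilityMeasure (slotLaw N) := by
  unfold slotLaw; infer_instance

instance (N : Network K) (i : Fin K) : IsProbabilityMeasure (rsuLaw N i) := by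
  have := isProbabilityMeasure_expMeasure (inv_pos.2 (N.meanSNR₁_pos i))
  have := isProbabilityMeasure_expMeasure (inv_pos.2 (N.meanSNR₂_pos i))
  unfold rsuLaw; infer_instance

instance (N : Network K) (i : Fin K) : IsProbabilityMeasure (snrLaw N i) := by
  have := isProbabilityMeasure_expMeasure (inv_pos.2 (N.meanSNR_pos i))
  unfold snrLaw; infer_instance

instance (N : Network K) : IsProbabilityMeasure (roundLaw N) := by
  unfold roundLaw; infer_instance

instance (N : Network K) : IsProbabilityMeasure (pathLaw N) := by
  unfold pathLaw; infer_instance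

/-- No source sends. -/
def Slot.IsIdle (s : Slot K) : Prop := ∀ i, s i = false

/-- Exactly one source sends. -/
def Slot.IsSuccess (s : Slot K) : Prop := ∃! i, s i = true

/-- Index of the first successful slot of a contention. -/
def Round.successSlot (x : Round K) : ℕ := sInf {n | (x.1 n).IsSuccess}

open Classical in
/-- Winner of the contention: the source that sends in the first successful slot. The default value
is irrelevant, since almost surely there is a successful slot. -/
def Round.winner [NeZero K] (x : Round K) : Fin K :=
  if h : ∃ i, x.1 x.successSlot i = true then h.choose else 0

open Classical in
/-- Contention time: each idle slot lasts `δ`, each collision lasts `τR`, and the final successful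
slot lasts `τR + τC`. -/
def contentionTime (N : Network K) (x : Round K) : ℝ :=
  (∑ n ∈ Finset.range x.successSlot, if (x.1 n).IsIdle then N.δ else N.τR) + (N.τR + N.τC)

/-! ### Rates and rewards -/

/-- Achievable rate of V2V transmission at the V2V SNR `γ`. -/
def rateD (γ : ℝ) : ℝ := Real.logb 2 (1 + γ)

/-- Received SNR at the destination with (amplify-and-forward) relaying by the RSU. -/
def relaySNR (γ γ₁ γ₂ : ℝ) : ℝ := γ + γ₁ * γ₂ / (γ₁ + γ₂ + 1)

/-- Achievable rate of RSU-aided transmission. -/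
def rateR (γ γ₁ γ₂ : ℝ) : ℝ := (1 / 2) * Real.logb 2 (1 + relaySNR γ γ₁ γ₂)

/-- The quantity `max {τ_{d,1} max {R_d, R_r} - lam τ_d, - lam τ_1}`. -/
def probeReward (N : Network K) (lam γ γ₁ γ₂ : ℝ) : ℝ :=
  max (N.τd₁ * max (rateD γ) (rateR γ γ₁ γ₂) - lam * N.τd) (-lam * N.τ₁)

/-- The threshold function `W_i(γ, lam)`: the conditional expectation of `probeReward` given that
pair `i` has won and that its V2V SNR is `γ`. As `(γ_{1,i}, γ_{2,i})` is independent of the winner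
and of `γ_i`, its conditional law is `rsuLaw N i`. -/
def W (N : Network K) (i : Fin K) (γ lam : ℝ) : ℝ :=
  ∫ g, probeReward N lam γ g.1 g.2 ∂(rsuLaw N i)

/-! ### Observations and strategies -/

/-- The first observation of a round: contention time, winner, V2V SNR of the winner. -/
abbrev FirstObs (K : ℕ) : Type := ℝ × Fin K × ℝ

/-- The second (optional) observation of a round: the SNRs `(γ₁, γ₂)` of the winner's RSU links. -/
abbrev SecondObs : Type := ℝ × ℝ

/-- All that has been observed in a past round: the first observation, whether the RSU was probed
and, if so, the second observation (`(0, 0)` is recorded if the RSU was not probed). -/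
abbrev RoundRecord (K : ℕ) : Type := FirstObs K × Bool × SecondObs

/-- Decisions after the first observation; `transmit` is the decision to stop. -/
inductive FirstAction where
  | transmit
  | recontend
  | probe

/-- Decisions after the second observation; `transmit` is the decision to stop. -/
inductive SecondAction where
  | transmit
  | recontend

instance : MeasurableSpace FirstAction := ⊤
instance : MeasurableSpace SecondAction := ⊤

/-- A sequential strategy: each decision is a function of all that has been observed so far,
namely the records of the `k` past rounds and the observations of the current round. -/
structure Strategy (K : ℕ) where
  /-- decision after the first observation of round `k` -/
  first : (k : ℕ) → (Fin k → RoundRecord K) → FirstObs K → FirstAction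
  /-- decision after the second observation of round `k`, used only if the RSU was probed -/
  second : (k : ℕ) → (Fin k → RoundRecord K) → FirstObs K → SecondObs → SecondAction

/-- The decision functions are measurable. -/
structure Strategy.IsMeasurable (S : Strategy K) : Prop where
  first : ∀ k, Measurable fun a : (Fin k → RoundRecord K) × FirstObs K => S.first k a.1 a.2
  second : ∀ k, Measurable fun a : (Fin k → RoundRecord K) × FirstObs K × SecondObs =>
    S.second k a.1 a.2.1 a.2.2

section Play

variable [NeZero K]

/-- First observation in a round. -/
def firstObs (N : Network K) (x : Round K) : FirstObs K :=
  (contentionTime N x, x.winner, (x.2 x.winner).1)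

/-- Second observation in a round, if made. -/
def secondObs (x : Round K) : SecondObs := (x.2 x.winner).2

/-- The record of a round in which the first decision is `a`. -/
def recordOf (N : Network K) (x : Round K) : FirstAction → RoundRecord K
  | .probe => (firstObs N x, true, secondObs x)
  | _ => (firstObs N x, false, (0, 0))

/-- The records of the rounds before round `k` under the strategy `S`. -/
def history (N : Network K) (S : Strategy K) (ω : Path K) : (k : ℕ) → Fin k → RoundRecord K
  | 0 => Fin.elim0
  | k + 1 => Fin.snoc (α := fun _ => RoundRecord K) (history N S ω k)
      (recordOf N (ω k) (S.first k (history N S ω k) (firstObs N (ω k))))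

/-- Decision taken after the first observation of round `k`. -/
def firstDecision (N : Network K) (S : Strategy K) (ω : Path K) (k : ℕ) : FirstAction :=
  S.first k (history N S ω k) (firstObs N (ω k))

/-- Decision taken after the second observation of round `k` (if made). -/
def secondDecision (N : Network K) (S : Strategy K) (ω : Path K) (k : ℕ) : SecondAction :=
  S.second k (history N S ω k) (firstObs N (ω k)) (secondObs (ω k))

/-- `S` tells to stop in round `k`, either directly or after probing the RSU. -/
def StopsAt (N : Network K) (S : Strategy K) (ω : Path K) (k : ℕ) : Prop :=
  firstDecision N S ω k = .transmit ∨
    (firstDecision N S ω k = .probe ∧ secondDecision N S ω k = .transmit)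

/-- The (zero-based) index of the round in which `S` stops. -/
def stopRound (N : Network K) (S : Strategy K) (ω : Path K) : ℕ := sInf {k | StopsAt N S ω k}

open Classical in
/-- The reward `Y`: the amount of data transmitted by stopping. -/
def reward (N : Network K) (S : Strategy K) (ω : Path K) : ℝ :=
  let k := stopRound N S ω
  let γ := (firstObs N (ω k)).2.2
  let g := secondObs (ω k)
  if firstDecision N S ω k = .transmit then N.τd * rateD γ
  else N.τd₁ * max (rateD γ) (rateR γ g.1 g.2)

open Classical in
/-- The time cost `T`: all contention times, the RSU probings in the rounds before the last one, and
`τ_d` (which accounts for a probing in the last round and for the data transmission). -/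
def timeCost (N : Network K) (S : Strategy K) (ω : Path K) : ℝ :=
  (∑ l ∈ Finset.range (stopRound N S ω + 1), contentionTime N (ω l))
    + (∑ l ∈ Finset.range (stopRound N S ω), if firstDecision N S ω l = .probe then N.τ₁ else 0)
    + N.τd

/-- Feasible strategies: measurable, almost surely stopping, with finite mean time cost. -/
structure Strategy.IsFeasible (N : Network K) (S : Strategy K) : Prop where
  measurable : S.IsMeasurable
  stops : ∀ᵐ ω ∂(pathLaw N), ∃ k, StopsAt N S ω k
  integrable_timeCost : Integrable (timeCost N S) (pathLaw N)

/-- The average network throughput `E[Y] / E[T]` of a strategy. -/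
def throughput (N : Network K) (S : Strategy K) : ℝ :=
  (∫ ω, reward N S ω ∂(pathLaw N)) / ∫ ω, timeCost N S ω ∂(pathLaw N)

/-- The random variable `max {τ_d R_d - lam τ_d, 0, W_w(γ_w, lam)}`, with `w` the winner. -/
def bellmanReward (N : Network K) (lam : ℝ) (x : Round K) : ℝ :=
  max (N.τd * rateD (x.2 x.winner).1 - lam * N.τd)
    (max 0 (W N x.winner (x.2 x.winner).1 lam))

/-- The equation `E[max {τ_d R_d - lam τ_d, 0, W_w(γ_w, lam)}] = lam τ_o`. -/
def BellmanEquation (N : Network K) (lam : ℝ) : Prop :=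
  ∫ x, bellmanReward N lam x ∂(roundLaw N) = lam * N.τo

end Play

open Classical in
/-- The strategy RPCA at the price `lam`. -/
def rpca (N : Network K) (lam : ℝ) : Strategy K where
  first _ _ o :=
    let i := o.2.1
    let γ := o.2.2
    let r := N.τd * rateD γ - lam * N.τd
    if max (W N i γ lam) 0 ≤ r then .transmit
    else if r < 0 ∧ W N i γ lam < 0 then .recontend
    else .probe
  second _ _ o g :=
    if lam ≤ max (rateD o.2.2) (rateR o.2.2 g.1 g.2) then .transmit else .recontend

end

end VANET

/-! Time is charged at a price `lam` per unit, and the net gain `E[Y] - lam * E[T]` is split over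
the rounds. Reward and time cost are sums of contributions of the rounds up to the stopping round:
`roundReward` for the reward, `contentionTime + roundTime` for the cost (`reward_eq_sum`,
`timeCost_eq_sum`). Whether round `l` is reached depends on earlier rounds only, so round `l` is
independent of that event. Given the past, the decisions in round `l` are just a rule for one round.

For one round the optimum is explicit. After probing, the better decision yields `probeReward`. Its
mean over the RSU links of the winner, which are independent of the first observation, is `W`. Hence
no rule has mean gain above `E[bellmanReward] - lam * τo`, and the rule of `rpca` has exactly this
gain (`integral_roundGain_le`, `integral_roundGain_rpca`). When `lam` solves the optimality equation
this number is `0`. Summation over the rounds then gives `E[Y] ≤ lam * E[T]` for every feasible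
strategy, with equality for RPCA. Going to the next round has value `0` at this price, so no
recursion over rounds is needed.

Three points remain. The equation has exactly one root because its left side is antitone and
Lipschitz in `lam` and positive at `0`, while its right side increases strictly
(`exists_bellmanEquation_iff`). Summation and expectation may be exchanged because every round lasts
at least `τR + τC`, so that a finite mean time cost bounds the mean number of rounds
(`summable_alive`, `integrable_courseSum`). RPCA is feasible because a rule that almost never stops
would lose a fixed amount per round on average, contrary to its mean gain `0` (`rpcaStop_pos`). -/

namespace VANET

/-! ### Sums up to a random index and resampling of a coordinate -/

section General

variable {Ω : Type*} [MeasurableSpace Ω] {P : Measure Ω}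

/-- Exchange of expectation and a sum with a random number `n` of terms. -/
lemma integrable_randomSum {n : Ω → ℕ} {A : ℕ → Set Ω} {f : ℕ → Ω → ℝ}
    (hn : ∀ᵐ ω ∂P, ∀ l, ω ∈ A l ↔ l < n ω)
    (hf : ∀ l, Integrable ((A l).indicator (f l)) P)
    (hs : Summable fun l => ∫ ω, ‖(A l).indicator (f l) ω‖ ∂P) :
    Integrable (fun ω => ∑ l ∈ Finset.range (n ω), f l ω) P ∧
      HasSum (fun l => ∫ ω, (A l).indicator (f l) ω ∂P)
        (∫ ω, ∑ l ∈ Finset.range (n ω), f l ω ∂P) := by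
  have key : ∀ᵐ ω ∂P, HasSum (fun l => (A l).indicator (f l) ω)
      (∑ l ∈ Finset.range (n ω), f l ω) := by
    filter_upwards [hn] with ω hω
    have h1 : ∑ l ∈ Finset.range (n ω), f l ω
        = ∑ l ∈ Finset.range (n ω), (A l).indicator (f l) ω :=
      Finset.sum_congr rfl fun l hl => by
        rw [Set.indicator_of_mem ((hω l).2 (Finset.mem_range.1 hl))]
    rw [h1]
    refine hasSum_sum_of_ne_finset_zero fun l hl => ?_
    rw [Set.indicator_of_notMem]
    rw [hω l]
    simpa using hl
  have h2 := hasSum_integral_of_summable_integral_norm hf hs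
  have h3 : (∫ ω, ∑' l, (A l).indicator (f l) ω ∂P)
      = ∫ ω, ∑ l ∈ Finset.range (n ω), f l ω ∂P :=
    integral_congr_ae (key.mono fun ω h => h.tsum_eq)
  refine ⟨?_, h3 ▸ h2⟩
  -- `n` is not assumed measurable; the measurability of the random sum comes from the partial sums
  -- of the indicator series.
  refine ⟨aestronglyMeasurable_of_tendsto_ae atTop
    (f := fun k ω => ∑ l ∈ Finset.range k, (A l).indicator (f l) ω)
    (fun k => (integrable_finsetSum _ fun l _ => hf l).aestronglyMeasurable)
    (key.mono fun ω h => h.tendsto_sum_nat), ?_⟩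
  have h4 : ∀ᵐ ω ∂P, ‖∑ l ∈ Finset.range (n ω), f l ω‖ₑ
      ≤ ∑' l, ‖(A l).indicator (f l) ω‖ₑ := by
    filter_upwards [hn] with ω hω
    refine (enorm_sum_le _ _).trans ?_
    refine le_trans (Finset.sum_le_sum fun l hl => ?_)
      (ENNReal.sum_le_tsum (Finset.range (n ω)))
    rw [Set.indicator_of_mem ((hω l).2 (Finset.mem_range.1 hl))]
  refine (lintegral_mono_ae h4).trans_lt ?_
  rw [lintegral_tsum fun l => (hf l).aestronglyMeasurable.enorm]
  have h5 : ∀ l, ∫⁻ ω, ‖(A l).indicator (f l) ω‖ₑ ∂P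
      = ENNReal.ofReal (∫ ω, ‖(A l).indicator (f l) ω‖ ∂P) := fun l =>
    (ofReal_integral_norm_eq_lintegral_enorm (hf l)).symm
  simp_rw [h5]
  rw [← ENNReal.ofReal_tsum_of_nonneg (fun l => integral_nonneg fun _ => norm_nonneg _) hs]
  exact ENNReal.ofReal_lt_top

variable {ι X : Type*} [DecidableEq ι] [MeasurableSpace X]

/-- Replacing a coordinate of an i.i.d. family by an independent copy does not change its law. -/
lemma measurePreserving_update (μ : Measure X) [IsProbabilityMeasure μ] (l : ι) :
    MeasurePreserving (fun p : (ι → X) × X => Function.update p.1 l p.2)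
      ((Measure.infinitePi fun _ : ι => μ).prod μ) (Measure.infinitePi fun _ : ι => μ) := by
  have hm : Measurable (fun p : (ι → X) × X => Function.update p.1 l p.2) := measurable_update'
  refine ⟨hm, Measure.eq_infinitePi _ fun s t ht => ?_⟩
  rw [Measure.map_apply hm (MeasurableSet.pi s.countable_toSet fun i _ => ht i)]
  -- A box pulls back to a box: the condition on the coordinate `l`, if there is one, moves to the
  -- independent copy.
  have h : (fun p : (ι → X) × X => Function.update p.1 l p.2) ⁻¹' (Set.pi (s : Set ι) t)
      = (Set.pi ((s.erase l : Finset ι) : Set ι) t) ×ˢ (if l ∈ s then t l else Set.univ) := by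
    ext ⟨ω, y⟩
    simp only [Set.mem_preimage, Set.mem_pi, Finset.mem_coe, Set.mem_prod, Finset.mem_erase]
    constructor
    · intro h
      refine ⟨fun i hi => by simpa [hi.1] using h i hi.2, ?_⟩
      split_ifs with hl
      · simpa using h l hl
      · trivial
    · rintro ⟨h1, h2⟩ i hi
      by_cases hil : i = l
      · subst hil
        simpa [hi] using h2
      · simpa [hil] using h1 i ⟨hil, hi⟩
  rw [h, Measure.prod_prod, Measure.infinitePi_pi _ fun i _ => ht i]
  split_ifs with hl
  · exact Finset.prod_erase_mul s (fun i => μ (t i)) hl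
  · simp [Finset.erase_eq_of_notMem hl]

/-- Fubini for an i.i.d. family: a coordinate is integrated out first. -/
lemma integral_resample (μ : Measure X) [IsProbabilityMeasure μ] (l : ι)
    {F : (ι → X) → ℝ} (hF : Integrable F (Measure.infinitePi fun _ : ι => μ)) :
    ∫ ω, F ω ∂(Measure.infinitePi fun _ : ι => μ)
      = ∫ ω, ∫ y, F (Function.update ω l y) ∂μ ∂(Measure.infinitePi fun _ : ι => μ) := by
  have hp := measurePreserving_update (ι := ι) μ l
  have hi : Integrable (fun p : (ι → X) × X => F (Function.update p.1 l p.2))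
      ((Measure.infinitePi fun _ : ι => μ).prod μ) := hp.integrable_comp_of_integrable hF
  rw [← integral_prod _ hi]
  conv_lhs => rw [← hp.map_eq]
  refine integral_map hp.measurable.aemeasurable ?_
  rw [hp.map_eq]
  exact hF.aestronglyMeasurable

/-- An event not depending on the coordinate `l` is independent of this coordinate. -/
lemma integral_indicator_eval (μ : Measure X) [IsProbabilityMeasure μ] (l : ι)
    {A : Set (ι → X)} (hA : MeasurableSet A) (hAl : ∀ ω y, Function.update ω l y ∈ A ↔ ω ∈ A)
    {h : X → ℝ} (hh : Integrable h μ) :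
    Integrable (A.indicator fun ω => h (ω l)) (Measure.infinitePi fun _ : ι => μ) ∧
    ∫ ω, A.indicator (fun ω => h (ω l)) ω ∂(Measure.infinitePi fun _ : ι => μ)
      = (Measure.infinitePi fun _ : ι => μ).real A * ∫ x, h x ∂μ := by
  have h1 : Integrable (A.indicator fun ω => h (ω l)) (Measure.infinitePi fun _ : ι => μ) :=
    ((measurePreserving_eval_infinitePi (fun _ : ι => μ) l).integrable_comp_of_integrable
      hh).indicator hA
  refine ⟨h1, ?_⟩
  rw [integral_resample μ l h1]
  have h2 : ∀ ω, ∫ y, A.indicator (fun ω => h (ω l)) (Function.update ω l y) ∂μ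
      = A.indicator (fun _ => ∫ x, h x ∂μ) ω := by
    intro ω
    by_cases hω : ω ∈ A
    · rw [Set.indicator_of_mem hω]
      refine integral_congr_ae (ae_of_all _ fun y => ?_)
      simp [Set.indicator_of_mem ((hAl ω y).2 hω)]
    · rw [Set.indicator_of_notMem hω]
      refine (integral_congr_ae (ae_of_all _ fun y => ?_)).trans (integral_zero X ℝ)
      exact Set.indicator_of_notMem (fun h => hω ((hAl ω y).1 h)) _
  simp_rw [h2]
  rw [integral_indicator hA]
  simp

/-- In an i.i.d. sequence, the probability that `D` is avoided for `n` steps. -/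
lemma infinitePi_real_avoid (μ : Measure X) [IsProbabilityMeasure μ] {D : Set X}
    (hD : MeasurableSet D) (n : ℕ) :
    (Measure.infinitePi fun _ : ℕ => μ).real {ω | ∀ j < n, ω j ∉ D} = (1 - μ.real D) ^ n := by
  have h : {ω : ℕ → X | ∀ j < n, ω j ∉ D} = Set.pi (Finset.range n : Set ℕ) fun _ => Dᶜ := by
    ext ω; simp
  rw [h, measureReal_def, Measure.infinitePi_pi _ fun _ _ => hD.compl]
  rw [Finset.prod_const, Finset.card_range, ENNReal.toReal_pow, ← measureReal_def,
    probReal_compl_eq_one_sub hD]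

lemma measurableSet_avoid {D : Set X} (hD : MeasurableSet D) (n : ℕ) :
    MeasurableSet {ω : ℕ → X | ∀ j < n, ω j ∉ D} := by
  have h : {ω : ℕ → X | ∀ j < n, ω j ∉ D} = ⋂ j ∈ Finset.range n, (fun ω => ω j) ⁻¹' Dᶜ := by
    ext ω; simp
  rw [h]
  exact Finset.measurableSet_biInter _ fun j _ => measurable_pi_apply j hD.compl

/-- In an i.i.d. sequence, an event of positive probability occurs almost surely. -/
lemma ae_exists_mem (μ : Measure X) [IsProbabilityMeasure μ] {D : Set X}
    (hD : MeasurableSet D) (h0 : 0 < μ.real D) :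
    ∀ᵐ ω ∂(Measure.infinitePi fun _ : ℕ => μ), ∃ n, ω n ∈ D := by
  rw [ae_iff]
  have h1 : ∀ n, (Measure.infinitePi fun _ : ℕ => μ).real {ω | ¬ ∃ n, ω n ∈ D}
      ≤ (1 - μ.real D) ^ n := fun n => by
    rw [← infinitePi_real_avoid μ hD n]
    exact measureReal_mono fun ω hω j _ hj => hω ⟨j, hj⟩
  have h2 : Tendsto (fun n => (1 - μ.real D) ^ n) atTop (nhds 0) :=
    tendsto_pow_atTop_nhds_zero_of_lt_one (sub_nonneg.2 measureReal_le_one) (by linarith)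
  have h3 := ge_of_tendsto' h2 h1
  exact (measureReal_eq_zero_iff (by finiteness)).1 (le_antisymm h3 measureReal_nonneg)

end General

/-! ### Exponential variables -/

/-- The density vanishes on the negative half-line, and `0` is a null point. The bounds on the rates
need nonnegative SNRs, so they hold only almost surely. -/
lemma ae_pos_expMeasure (r : ℝ) : ∀ᵐ x ∂(expMeasure r), 0 < x := by
  unfold expMeasure gammaMeasure
  have hm : Measurable (gammaPDF 1 r) := (measurable_gammaPDFReal 1 r).ennreal_ofReal
  rw [ae_withDensity_iff hm]
  have h0 : ∀ᵐ x : ℝ ∂volume, x ≠ 0 := by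
    simp [ae_iff]
  filter_upwards [h0] with x hx h
  by_contra hneg
  exact h (gammaPDF_of_neg (lt_of_le_of_ne (not_lt.1 hneg) hx))

lemma integrable_id_expMeasure {r : ℝ} (hr : 0 < r) : Integrable (fun x => x) (expMeasure r) := by
  unfold expMeasure gammaMeasure
  have hm : Measurable (gammaPDF 1 r) := (measurable_gammaPDFReal 1 r).ennreal_ofReal
  rw [integrable_withDensity_iff hm
    (ae_of_all _ fun x => ENNReal.ofReal_lt_top)]
  have h1 : IntegrableOn (fun x : ℝ => x ^ (1 : ℝ) * Real.exp (-r * x)) (Set.Ioi 0) :=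
    (integrableOn_rpow_mul_exp_neg_mul_rpow (s := 1) (p := 1) (by norm_num) one_pos hr).congr_fun
      (fun x _ => by simp) measurableSet_Ioi
  have h2 := (h1.integrable_indicator measurableSet_Ioi).const_mul r
  refine h2.congr (ae_of_all _ fun x => ?_)
  simp only [gammaPDF, gammaPDFReal, Set.indicator, Set.mem_Ioi]
  rcases lt_trichotomy x 0 with hx | hx | hx
  · simp [hx.not_gt, hx.not_ge]
  · simp [hx]
  · rw [if_pos hx, if_pos hx.le, ENNReal.toReal_ofReal (by simp; positivity)]
    simp
    ring

variable {K : ℕ}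

/-! ### Contention slots -/

lemma slotLaw_real_singleton (N : Network K) (s : Slot K) :
    (slotLaw N).real {s} = ∏ i, if s i then N.p0 else 1 - N.p0 := by
  classical
  unfold slotLaw
  rw [measureReal_def, Measure.pi_singleton, ENNReal.toReal_prod]
  refine Finset.prod_congr rfl fun i _ => ?_
  rw [← measureReal_def, bernoulliMeasure_real_apply _ (MeasurableSet.singleton _)]
  cases s i <;> simp

lemma slotLaw_real_idle (N : Network K) :
    (slotLaw N).real {s | s.IsIdle} = (1 - N.p0) ^ K := by
  have h : {s : Slot K | s.IsIdle} = {fun _ => false} := by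
    ext s
    simp [Slot.IsIdle, funext_iff]
  rw [h, slotLaw_real_singleton]
  simp

lemma slotLaw_real_success (N : Network K) :
    (slotLaw N).real {s | s.IsSuccess} = N.pSucc := by
  classical
  have h : {s : Slot K | s.IsSuccess}
      = ⋃ i ∈ (Finset.univ : Finset (Fin K)), {fun j => decide (j = i)} := by
    ext s
    simp only [Slot.IsSuccess, ExistsUnique, Set.mem_ofPred_eq, Finset.mem_univ, Set.iUnion_true,
      Set.mem_iUnion, Set.mem_singleton_iff]
    refine exists_congr fun i => ⟨fun h => funext fun j => ?_, ?_⟩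
    · by_cases hj : j = i
      · simp [hj, h.1]
      · simpa [hj] using fun h' => hj (h.2 j h')
    · rintro rfl
      simp
  rw [h, measureReal_biUnion_finset]
  · have : ∀ i : Fin K, (slotLaw N).real {fun j => decide (j = i)}
        = N.p0 * (1 - N.p0) ^ (K - 1) := fun i => by
      rw [slotLaw_real_singleton, ← Finset.mul_prod_erase _ _ (Finset.mem_univ i)]
      simp only [decide_true, if_true]
      congr 1
      rw [Finset.prod_congr rfl (g := fun _ => 1 - N.p0)]
      · simp
      · intro j hj
        simp [Finset.ne_of_mem_erase hj]
    simp [this, Network.pSucc]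
    ring
  · intro i _ j _ hij
    refine Set.disjoint_singleton.2 fun h => hij ?_
    simpa using congrFun h i
  · exact fun i _ => MeasurableSet.singleton _

lemma Network.pSucc_pos [NeZero K] (N : Network K) : 0 < N.pSucc := by
  have h1 : (0 : ℝ) < K := Nat.cast_pos.2 (NeZero.pos K)
  have h2 := N.p0_pos
  have h3 : 0 < 1 - N.p0 := sub_pos.2 N.p0_lt_one
  unfold Network.pSucc
  positivity

lemma measurableSet_slot (D : Set (Slot K)) : MeasurableSet D := D.toFinite.measurableSet

open Classical in
/-- Duration of an unsuccessful slot, as a function of the slot. -/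
noncomputable def failTime (N : Network K) (s : Slot K) : ℝ := if s.IsIdle then N.δ else N.τR

lemma failTime_pos (N : Network K) (s : Slot K) : 0 < failTime N s := by
  unfold failTime
  split_ifs
  exacts [N.δ_pos, N.τR_pos]

/-- Unsuccessful slots have mean duration `τo - τR - τC`, when weighted by `1 / pSucc`. -/
lemma integral_failTime [NeZero K] (N : Network K) :
    ∫ s, {s : Slot K | s.IsSuccess}ᶜ.indicator (failTime N) s ∂(slotLaw N)
      = (N.τo - (N.τR + N.τC)) * N.pSucc := by
  classical
  have hq := N.pSucc_pos
  have hdis : Disjoint {s : Slot K | s.IsIdle} {s | s.IsSuccess} := by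
    rw [Set.disjoint_left]
    rintro s h ⟨i, hi, -⟩
    simp [h i] at hi
  -- Collisions are the slots that are neither idle nor successful.
  have h : {s : Slot K | s.IsSuccess}ᶜ.indicator (failTime N)
      = fun s => {s : Slot K | s.IsIdle}.indicator (fun _ => N.δ) s
        + ({s : Slot K | s.IsIdle} ∪ {s | s.IsSuccess})ᶜ.indicator (fun _ => N.τR) s := by
    funext s
    have : s.IsIdle → ¬ s.IsSuccess := fun h => Set.disjoint_left.1 hdis h
    by_cases h1 : s.IsIdle <;> by_cases h2 : s.IsSuccess <;>
      simp_all [failTime, Set.indicator]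
  rw [h, integral_add, integral_indicator (measurableSet_slot _),
    integral_indicator (measurableSet_slot _), setIntegral_const, setIntegral_const,
    probReal_compl_eq_one_sub (measurableSet_slot _),
    measureReal_union hdis (measurableSet_slot _), slotLaw_real_idle, slotLaw_real_success]
  · simp only [smul_eq_mul, Network.τo]
    field_simp
    ring
  · exact (integrable_const _).indicator (measurableSet_slot _)
  · exact (integrable_const _).indicator (measurableSet_slot _)

/-! ### Mean contention time -/

/-- Law of the sequence of slots. -/
noncomputable abbrev slotsLaw (N : Network K) : Measure (ℕ → Slot K) :=
  Measure.infinitePi fun _ => slotLaw N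

/-- Index of the first successful slot, as a function of the slots. -/
noncomputable def firstSuccess (s : ℕ → Slot K) : ℕ := sInf {n | (s n).IsSuccess}

lemma ae_exists_success [NeZero K] (N : Network K) : ∀ᵐ s ∂(slotsLaw N), ∃ n, (s n).IsSuccess :=
  ae_exists_mem (slotLaw N) (measurableSet_slot {s | s.IsSuccess})
    (by rw [slotLaw_real_success]; exact N.pSucc_pos)

/-- Existence of a successful slot is essential: otherwise `firstSuccess` is the infimum of the
empty set, which is `0`. -/
lemma lt_firstSuccess_iff {s : ℕ → Slot K} (h : ∃ n, (s n).IsSuccess) (l : ℕ) :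
    l < firstSuccess s ↔ ∀ j < l + 1, ¬ (s j).IsSuccess := by
  constructor
  · exact fun hl j hj => Nat.notMem_of_lt_sInf (lt_of_lt_of_le' hl (Nat.lt_succ_iff.1 hj))
  · intro hl
    by_contra hc
    exact hl _ (Nat.lt_succ_of_le (not_lt.1 hc)) (Nat.sInf_mem (s := {n | (s n).IsSuccess}) h)

/-- Slot `l` contributes only if it and all slots before it fail. By independence its mean
contribution is `(1 - pSucc) ^ l` times the mean duration of one slot restricted to failure, and the
geometric series cancels the factor `pSucc`. -/
lemma integral_sum_failTime [NeZero K] (N : Network K) :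
    Integrable (fun s => ∑ n ∈ Finset.range (firstSuccess s), failTime N (s n)) (slotsLaw N) ∧
    ∫ s, ∑ n ∈ Finset.range (firstSuccess s), failTime N (s n) ∂(slotsLaw N)
      = N.τo - (N.τR + N.τC) := by
  classical
  have hq := N.pSucc_pos
  set D : Set (Slot K) := {s | s.IsSuccess}
  set A : ℕ → Set (ℕ → Slot K) := fun l => {s | ∀ j < l, s j ∉ D}
  have hint : ∀ h : Slot K → ℝ, Integrable h (slotLaw N) := fun h => Integrable.of_finite
  -- Failure of the slots `0, …, l` is separated into failure before `l`, which is independent of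
  -- slot `l`, and failure of slot `l` itself.
  have hind : ∀ l, (A (l + 1)).indicator (fun s => failTime N (s l))
      = (A l).indicator (fun s => Dᶜ.indicator (failTime N) (s l)) := by
    intro l
    funext s
    by_cases h1 : s ∈ A l
    · by_cases h2 : s l ∈ D
      · rw [Set.indicator_of_notMem (fun h : s ∈ A (l + 1) => h l (Nat.lt_succ_self l) h2),
          Set.indicator_of_mem h1, Set.indicator_of_notMem (by simpa using h2)]
      · rw [Set.indicator_of_mem, Set.indicator_of_mem h1, Set.indicator_of_mem h2]
        intro j hj
        rcases Nat.lt_succ_iff_lt_or_eq.1 hj with hj | rfl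
        exacts [h1 j hj, h2]
    · rw [Set.indicator_of_notMem h1, Set.indicator_of_notMem]
      exact fun h => h1 fun j hj => h j (hj.trans (Nat.lt_succ_self l))
  have hstep := fun l => integral_indicator_eval (slotLaw N) l
    (measurableSet_avoid (measurableSet_slot D) l)
    (fun ω y => by
      simp only [Set.mem_ofPred_eq]
      exact forall₂_congr fun j hj => by rw [Function.update_of_ne hj.ne])
    (hint (Dᶜ.indicator (failTime N)))
  have hval : ∀ l, ∫ s, (A (l + 1)).indicator (fun s => failTime N (s l)) s ∂(slotsLaw N)
      = (1 - N.pSucc) ^ l * ((N.τo - (N.τR + N.τC)) * N.pSucc) := by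
    intro l
    rw [hind l, (hstep l).2, infinitePi_real_avoid _ (measurableSet_slot D),
      slotLaw_real_success, integral_failTime]
  have hle : N.pSucc ≤ 1 := by
    rw [← slotLaw_real_success]; exact measureReal_le_one
  have hgeo : HasSum (fun l => (1 - N.pSucc) ^ l * ((N.τo - (N.τR + N.τC)) * N.pSucc))
      (N.τo - (N.τR + N.τC)) := by
    have := (hasSum_geometric_of_lt_one (sub_nonneg.2 hle) (by linarith)).mul_right
      ((N.τo - (N.τR + N.τC)) * N.pSucc)
    rwa [sub_sub_cancel, mul_comm _ N.pSucc, inv_mul_cancel_left₀ hq.ne', mul_comm N.pSucc] at this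
  have hmain := integrable_randomSum (P := slotsLaw N) (n := firstSuccess)
    (A := fun l => A (l + 1)) (f := fun l s => failTime N (s l))
    (by
      filter_upwards [ae_exists_success N] with s hs l
      rw [lt_firstSuccess_iff hs]
      rfl)
    (fun l => by rw [hind l]; exact (hstep l).1)
    (by
      have : ∀ l s, ‖(A (l + 1)).indicator (fun s => failTime N (s l)) s‖
          = (A (l + 1)).indicator (fun s => failTime N (s l)) s := fun l s =>
        Real.norm_of_nonneg (Set.indicator_nonneg (fun s _ => (failTime_pos N _).le) _)
      simp_rw [this, hval]
      exact hgeo.summable)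
  refine ⟨hmain.1, ?_⟩
  have := hmain.2
  simp_rw [hval] at this
  exact this.unique hgeo

lemma contentionTime_eq (N : Network K) (x : Round K) :
    contentionTime N x
      = ∑ n ∈ Finset.range (firstSuccess x.1), failTime N (x.1 n) + (N.τR + N.τC) := rfl

lemma le_contentionTime (N : Network K) (x : Round K) : N.τR + N.τC ≤ contentionTime N x := by
  rw [contentionTime_eq]
  exact le_add_of_nonneg_left (Finset.sum_nonneg fun _ _ => (failTime_pos N _).le)

lemma integrable_contentionTime [NeZero K] (N : Network K) :
    Integrable (contentionTime N) (roundLaw N) := by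
  have h : Integrable (fun x : Round K =>
      ∑ n ∈ Finset.range (firstSuccess x.1), failTime N (x.1 n)) (roundLaw N) :=
    (integral_sum_failTime N).1.comp_fst _
  exact h.add (integrable_const _)

lemma integral_contentionTime [NeZero K] (N : Network K) :
    ∫ x, contentionTime N x ∂(roundLaw N) = N.τo := by
  have h : Integrable (fun x : Round K =>
      ∑ n ∈ Finset.range (firstSuccess x.1), failTime N (x.1 n)) (roundLaw N) :=
    (integral_sum_failTime N).1.comp_fst _
  simp_rw [contentionTime_eq]
  rw [integral_add h (integrable_const _)]
  unfold roundLaw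
  rw [integral_fun_fst (fun s => ∑ n ∈ Finset.range (firstSuccess s), failTime N (s n)),
    (integral_sum_failTime N).2]
  simp

lemma Network.τo_pos [NeZero K] (N : Network K) : 0 < N.τo := by
  have h0 : N.τR + N.τC ≤ N.τo := by
    rw [← integral_contentionTime N]
    have := integral_mono (μ := roundLaw N) (integrable_const _) (integrable_contentionTime N)
      (le_contentionTime N)
    simpa using this
  linarith [N.τR_pos, N.τC_pos]

/-! ### Measurability of the observations -/

lemma measurable_firstSuccess : Measurable (firstSuccess (K := K)) := by
  have hms : ∀ n, MeasurableSet {s : ℕ → Slot K | (s n).IsSuccess} := fun n => by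
    simpa using measurable_pi_apply (X := fun _ : ℕ => Slot K) n (measurableSet_slot {s | s.IsSuccess})
  refine measurable_of_Iio fun m => ?_
  -- The second set collects the sequences without success, where the default value `0` lies below
  -- every positive `m`.
  have h : firstSuccess (K := K) ⁻¹' Set.Iio m
      = {s | ∃ n, n < m ∧ (s n).IsSuccess} ∪ {s | 0 < m ∧ ∀ n, ¬ (s n).IsSuccess} := by
    ext s
    simp only [Set.mem_preimage, Set.mem_Iio, Set.mem_union, Set.mem_ofPred_eq, firstSuccess]
    by_cases hs : ∃ n, (s n).IsSuccess
    · constructor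
      · exact fun h => Or.inl ⟨_, h, Nat.sInf_mem (s := {n | (s n).IsSuccess}) hs⟩
      · rintro (⟨n, hn, h⟩ | ⟨_, h⟩)
        · exact (Nat.sInf_le (s := {n | (s n).IsSuccess}) h).trans_lt hn
        · exact absurd hs (not_exists.2 h)
    · have he : {n | (s n).IsSuccess} = ∅ := Set.eq_empty_of_forall_notMem (not_exists.1 hs)
      have hs' := not_exists.1 hs
      rw [he, Nat.sInf_empty]
      simp [hs']
  rw [h]
  refine MeasurableSet.union ?_ ?_
  · simp only [measurableSet_setOfPred]
    exact Measurable.exists fun n => Measurable.and measurable_const (measurableSet_setOfPred.1 (hms n))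
  · simp only [measurableSet_setOfPred]
    exact Measurable.and measurable_const
      (Measurable.forall fun n => (measurableSet_setOfPred.1 (hms n)).not)

lemma measurable_contentionTime (N : Network K) : Measurable (contentionTime N) := by
  -- A random index ranges over a countable type, so measurability for each fixed index suffices.
  have h1 : Measurable fun p : ℕ × (ℕ → Slot K) =>
      ∑ n ∈ Finset.range p.1, failTime N (p.2 n) :=
    measurable_from_prod_countable_right fun m =>
      Finset.measurable_sum (Finset.range m) fun n _ =>
        (measurable_of_finite (failTime N)).comp
          (measurable_pi_apply (X := fun _ : ℕ => Slot K) n)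
  have h2 : Measurable fun x : Round K => (firstSuccess x.1, x.1) :=
    (measurable_firstSuccess.comp measurable_fst).prodMk measurable_fst
  exact (h1.comp h2).add_const _

lemma measurable_winner [NeZero K] : Measurable (Round.winner (K := K)) := by
  classical
  have h1 : Measurable fun p : ℕ × (ℕ → Slot K) => p.2 p.1 :=
    measurable_from_prod_countable_right fun m => measurable_pi_apply m
  have h2 : Measurable fun x : Round K => (firstSuccess x.1, x.1) :=
    (measurable_firstSuccess.comp measurable_fst).prodMk measurable_fst
  exact (measurable_of_finite fun s : Slot K =>
    if h : ∃ i, s i = true then h.choose else 0).comp (h1.comp h2)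

lemma measurable_winnerSNR [NeZero K] : Measurable fun x : Round K => x.2 x.winner := by
  have h1 : Measurable fun p : Fin K × (Fin K → ℝ × ℝ × ℝ) => p.2 p.1 :=
    measurable_from_prod_countable_right fun m => measurable_pi_apply m
  exact h1.comp (measurable_winner.prodMk measurable_snd)

lemma measurable_firstObs [NeZero K] (N : Network K) : Measurable (firstObs N) :=
  (measurable_contentionTime N).prodMk
    (measurable_winner.prodMk measurable_winnerSNR.fst)

lemma measurable_secondObs [NeZero K] : Measurable (secondObs (K := K)) :=
  measurable_winnerSNR.snd

/-! ### Rates -/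

lemma measurable_rateD : Measurable rateD := by
  unfold rateD Real.logb
  fun_prop

lemma measurable_rateR : Measurable fun z : ℝ × ℝ × ℝ => rateR z.1 z.2.1 z.2.2 := by
  unfold rateR relaySNR Real.logb
  fun_prop

lemma measurable_probeReward (N : Network K) (lam : ℝ) :
    Measurable fun z : ℝ × ℝ × ℝ => probeReward N lam z.1 z.2.1 z.2.2 := by
  unfold probeReward
  have h1 : Measurable fun z : ℝ × ℝ × ℝ => rateD z.1 := measurable_rateD.comp measurable_fst
  exact (((h1.max measurable_rateR).const_mul _).sub_const _).max measurable_const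

lemma logb_two_one_add_nonneg {x : ℝ} (hx : 0 ≤ x) : 0 ≤ Real.logb 2 (1 + x) :=
  Real.logb_nonneg one_lt_two (by linarith)

/-- Linear growth is enough for integrability of the rates, since exponential variables have finite
means. -/
lemma logb_two_one_add_le {x : ℝ} (hx : 0 ≤ x) : Real.logb 2 (1 + x) ≤ x / Real.log 2 := by
  have h := Real.log_le_sub_one_of_pos (x := 1 + x) (by linarith)
  unfold Real.logb
  have := Real.log_pos one_lt_two
  gcongr
  linarith

lemma rateD_nonneg {γ : ℝ} (h : 0 ≤ γ) : 0 ≤ rateD γ := logb_two_one_add_nonneg h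

lemma rateD_pos {γ : ℝ} (h : 0 < γ) : 0 < rateD γ := Real.logb_pos one_lt_two (by linarith)

lemma rateD_le {γ : ℝ} (h : 0 ≤ γ) : rateD γ ≤ γ / Real.log 2 := logb_two_one_add_le h

lemma relaySNR_nonneg {γ γ₁ γ₂ : ℝ} (h : 0 ≤ γ) (h₁ : 0 ≤ γ₁) (h₂ : 0 ≤ γ₂) :
    0 ≤ relaySNR γ γ₁ γ₂ := by
  unfold relaySNR
  positivity

lemma relaySNR_le {γ γ₁ γ₂ : ℝ} (h₁ : 0 ≤ γ₁) (h₂ : 0 ≤ γ₂) : relaySNR γ γ₁ γ₂ ≤ γ + γ₁ := by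
  unfold relaySNR
  have : γ₁ * γ₂ / (γ₁ + γ₂ + 1) ≤ γ₁ := by
    rw [div_le_iff₀ (by positivity)]
    nlinarith [mul_nonneg h₁ h₁]
  linarith

lemma rateR_nonneg {γ γ₁ γ₂ : ℝ} (h : 0 ≤ γ) (h₁ : 0 ≤ γ₁) (h₂ : 0 ≤ γ₂) :
    0 ≤ rateR γ γ₁ γ₂ := by
  have := logb_two_one_add_nonneg (relaySNR_nonneg h h₁ h₂)
  unfold rateR
  positivity

lemma rateR_le {γ γ₁ γ₂ : ℝ} (h : 0 ≤ γ) (h₁ : 0 ≤ γ₁) (h₂ : 0 ≤ γ₂) :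
    rateR γ γ₁ γ₂ ≤ (γ + γ₁) / Real.log 2 := by
  have h3 := logb_two_one_add_nonneg (relaySNR_nonneg h h₁ h₂)
  have h4 := logb_two_one_add_le (relaySNR_nonneg h h₁ h₂)
  have h5 : relaySNR γ γ₁ γ₂ / Real.log 2 ≤ (γ + γ₁) / Real.log 2 := by
    have := Real.log_pos one_lt_two
    gcongr
    exact relaySNR_le h₁ h₂
  unfold rateR
  linarith

/-! ### Positivity of the SNRs and integrability of the rates -/

instance (N : Network K) (i : Fin K) : IsProbabilityMeasure (expMeasure (N.meanSNR i)⁻¹) :=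
  isProbabilityMeasure_expMeasure (inv_pos.2 (N.meanSNR_pos i))

instance (N : Network K) (i : Fin K) : IsProbabilityMeasure (expMeasure (N.meanSNR₁ i)⁻¹) :=
  isProbabilityMeasure_expMeasure (inv_pos.2 (N.meanSNR₁_pos i))

instance (N : Network K) (i : Fin K) : IsProbabilityMeasure (expMeasure (N.meanSNR₂ i)⁻¹) :=
  isProbabilityMeasure_expMeasure (inv_pos.2 (N.meanSNR₂_pos i))

lemma ae_pos_rsuLaw (N : Network K) (i : Fin K) : ∀ᵐ g ∂(rsuLaw N i), 0 < g.1 ∧ 0 < g.2 := by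
  unfold rsuLaw
  exact (Measure.quasiMeasurePreserving_fst.ae (ae_pos_expMeasure _)).and
    (Measure.quasiMeasurePreserving_snd.ae (ae_pos_expMeasure _))

lemma ae_pos_snrLaw (N : Network K) (i : Fin K) :
    ∀ᵐ z ∂(snrLaw N i), 0 < z.1 ∧ 0 < z.2.1 ∧ 0 < z.2.2 := by
  unfold snrLaw
  exact (Measure.quasiMeasurePreserving_fst.ae (ae_pos_expMeasure _)).and
    (Measure.quasiMeasurePreserving_snd.ae (ae_pos_rsuLaw N i))

lemma integrable_fst_rsuLaw (N : Network K) (i : Fin K) :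
    Integrable (fun g : ℝ × ℝ => g.1) (rsuLaw N i) :=
  (integrable_id_expMeasure (inv_pos.2 (N.meanSNR₁_pos i))).comp_fst _

lemma integrable_rateR_rsuLaw (N : Network K) (i : Fin K) {γ : ℝ} (hγ : 0 ≤ γ) :
    Integrable (fun g : ℝ × ℝ => rateR γ g.1 g.2) (rsuLaw N i) := by
  refine Integrable.mono' (((integrable_const γ).add (integrable_fst_rsuLaw N i)).div_const
    (Real.log 2)) (measurable_rateR.comp measurable_prodMk_left).aestronglyMeasurable ?_
  filter_upwards [ae_pos_rsuLaw N i] with g hg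
  rw [Real.norm_of_nonneg (rateR_nonneg hγ hg.1.le hg.2.le)]
  exact rateR_le hγ hg.1.le hg.2.le

lemma integrable_rateD_snrLaw (N : Network K) (i : Fin K) :
    Integrable (fun z : ℝ × ℝ × ℝ => rateD z.1) (snrLaw N i) := by
  have h1 : Integrable (fun z : ℝ × ℝ × ℝ => z.1) (snrLaw N i) :=
    (integrable_id_expMeasure (inv_pos.2 (N.meanSNR_pos i))).comp_fst _
  refine Integrable.mono' (h1.div_const (Real.log 2))
    (measurable_rateD.comp measurable_fst).aestronglyMeasurable ?_
  filter_upwards [ae_pos_snrLaw N i] with z hz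
  rw [Real.norm_of_nonneg (rateD_nonneg hz.1.le)]
  exact rateD_le hz.1.le

lemma integrable_rateR_snrLaw (N : Network K) (i : Fin K) :
    Integrable (fun z : ℝ × ℝ × ℝ => rateR z.1 z.2.1 z.2.2) (snrLaw N i) := by
  have h1 : Integrable (fun z : ℝ × ℝ × ℝ => z.1) (snrLaw N i) :=
    (integrable_id_expMeasure (inv_pos.2 (N.meanSNR_pos i))).comp_fst _
  have h2 : Integrable (fun z : ℝ × ℝ × ℝ => z.2.1) (snrLaw N i) :=
    (integrable_fst_rsuLaw N i).comp_snd _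
  refine Integrable.mono' ((h1.add h2).div_const (Real.log 2))
    measurable_rateR.aestronglyMeasurable ?_
  filter_upwards [ae_pos_snrLaw N i] with z hz
  rw [Real.norm_of_nonneg (rateR_nonneg hz.1.le hz.2.1.le hz.2.2.le)]
  exact rateR_le hz.1.le hz.2.1.le hz.2.2.le

lemma integrable_probeReward_rsuLaw (N : Network K) (i : Fin K) (lam : ℝ) {γ : ℝ} (hγ : 0 ≤ γ) :
    Integrable (fun g : ℝ × ℝ => probeReward N lam γ g.1 g.2) (rsuLaw N i) :=
  ((((integrable_const _).sup (integrable_rateR_rsuLaw N i hγ)).const_mul _).sub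
    (integrable_const _)).sup (integrable_const _)

lemma integrable_probeReward_snrLaw (N : Network K) (i : Fin K) (lam : ℝ) :
    Integrable (fun z : ℝ × ℝ × ℝ => probeReward N lam z.1 z.2.1 z.2.2) (snrLaw N i) :=
  ((((integrable_rateD_snrLaw N i).sup (integrable_rateR_snrLaw N i)).const_mul _).sub
    (integrable_const _)).sup (integrable_const _)

/-! ### The threshold functions -/

lemma measurable_W (N : Network K) (i : Fin K) (lam : ℝ) : Measurable fun γ => W N i γ lam := by
  have h : StronglyMeasurable fun p : ℝ × ℝ × ℝ => probeReward N lam p.1 p.2.1 p.2.2 :=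
    (measurable_probeReward N lam).stronglyMeasurable
  exact h.integral_prod_right.measurable

lemma measurable_W_uncurry (N : Network K) (lam : ℝ) :
    Measurable fun p : Fin K × ℝ => W N p.1 p.2 lam :=
  measurable_from_prod_countable_right fun i => measurable_W N i lam

lemma integrable_W (N : Network K) (i : Fin K) (lam : ℝ) :
    Integrable (fun z : ℝ × ℝ × ℝ => W N i z.1 lam) (snrLaw N i) :=
  (Integrable.integral_prod_left (integrable_probeReward_snrLaw N i lam)).comp_fst _

lemma probeReward_anti (N : Network K) (γ γ₁ γ₂ : ℝ) :
    Antitone fun lam => probeReward N lam γ γ₁ γ₂ := by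
  intro lam lam' h
  have h1 : 0 < N.τ₁ := add_pos N.τR_pos N.τC_pos
  have h2 : 0 < N.τd := h1.trans N.probe_lt
  unfold probeReward
  exact max_le_max (by nlinarith) (by nlinarith)

/-- As functions of the price, the two entries of the maximum have slopes `-τd` and `-τ₁`, and `τ₁ <
τd`. This is the source of the Lipschitz bound for the optimality equation. -/
lemma probeReward_le_add (N : Network K) (γ γ₁ γ₂ : ℝ) {lam lam' : ℝ} (h : lam ≤ lam') :
    probeReward N lam γ γ₁ γ₂ ≤ probeReward N lam' γ γ₁ γ₂ + (lam' - lam) * N.τd := by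
  have h1 : 0 < N.τ₁ := add_pos N.τR_pos N.τC_pos
  have h2 : N.τ₁ < N.τd := N.probe_lt
  unfold probeReward
  rw [max_add]
  exact max_le_max (by linarith) (by nlinarith)

lemma W_anti (N : Network K) (i : Fin K) {γ : ℝ} (hγ : 0 ≤ γ) :
    Antitone fun lam => W N i γ lam := fun lam lam' h =>
  integral_mono (integrable_probeReward_rsuLaw N i lam' hγ)
    (integrable_probeReward_rsuLaw N i lam hγ) fun _ => probeReward_anti N _ _ _ h

lemma W_le_add (N : Network K) (i : Fin K) {γ : ℝ} (hγ : 0 ≤ γ) {lam lam' : ℝ} (h : lam ≤ lam') :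
    W N i γ lam ≤ W N i γ lam' + (lam' - lam) * N.τd := by
  have h1 := integral_mono (integrable_probeReward_rsuLaw N i lam hγ)
    ((integrable_probeReward_rsuLaw N i lam' hγ).add (integrable_const ((lam' - lam) * N.τd)))
    fun g => probeReward_le_add N γ g.1 g.2 h
  refine h1.trans_eq ?_
  rw [integral_add' (integrable_probeReward_rsuLaw N i lam' hγ) (integrable_const _)]
  simp [W]

/-! ### Quantities of the winner -/

lemma measurePreserving_snr (N : Network K) (i : Fin K) :
    MeasurePreserving (fun x : Round K => x.2 i) (roundLaw N) (snrLaw N i) :=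
  (measurePreserving_eval (fun i => snrLaw N i) i).comp measurePreserving_snd

section Winner

variable [NeZero K]

lemma ae_winner (N : Network K) {p : Fin K → ℝ × ℝ × ℝ → Prop}
    (hp : ∀ i, ∀ᵐ z ∂(snrLaw N i), p i z) :
    ∀ᵐ x ∂(roundLaw N), p x.winner (x.2 x.winner) := by
  have h : ∀ᵐ x ∂(roundLaw N), ∀ i, p i (x.2 i) :=
    ae_all_iff.2 fun i => (measurePreserving_snr N i).quasiMeasurePreserving.ae (hp i)
  exact h.mono fun x hx => hx _

/-- The winner takes finitely many values, so the variable is a finite sum of restrictions of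
integrable ones; independence is not needed. -/
lemma integrable_winner (N : Network K) {h : Fin K → ℝ × ℝ × ℝ → ℝ}
    (hh : ∀ i, Integrable (h i) (snrLaw N i)) :
    Integrable (fun x => h x.winner (x.2 x.winner)) (roundLaw N) := by
  classical
  have h1 : (fun x : Round K => h x.winner (x.2 x.winner))
      = fun x => ∑ i, {x : Round K | x.winner = i}.indicator (fun x => h i (x.2 i)) x := by
    funext x
    simp [Set.indicator]
  rw [h1]
  exact integrable_finsetSum _ fun i _ =>
    ((measurePreserving_snr N i).integrable_comp_of_integrable (hh i)).indicator
      (measurable_winner (MeasurableSet.singleton i))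

lemma ae_pos_winner (N : Network K) :
    ∀ᵐ x ∂(roundLaw N), 0 < (x.2 x.winner).1 ∧ 0 < (x.2 x.winner).2.1 ∧ 0 < (x.2 x.winner).2.2 :=
  ae_winner N (p := fun _ z => 0 < z.1 ∧ 0 < z.2.1 ∧ 0 < z.2.2) (ae_pos_snrLaw N)

/-- The winner depends on the slots only. -/
noncomputable def slotsWinner (s : ℕ → Slot K) : Fin K := Round.winner (s, fun _ => 0)

/-- Integrating out the RSU links of the winner first. -/
lemma integral_indicator_winner (N : Network K) {h : Fin K → ℝ × ℝ × ℝ → ℝ}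
    (hh : ∀ i, Integrable (h i) (snrLaw N i)) {B : Set ((ℕ → Slot K) × ℝ)} (hB : MeasurableSet B) :
    ∫ x, {x : Round K | (x.1, (x.2 x.winner).1) ∈ B}.indicator
        (fun x => h x.winner (x.2 x.winner)) x ∂(roundLaw N)
      = ∫ x, {x : Round K | (x.1, (x.2 x.winner).1) ∈ B}.indicator
        (fun x => ∫ g, h x.winner ((x.2 x.winner).1, g) ∂(rsuLaw N x.winner)) x
          ∂(roundLaw N) := by
  classical
  have hB' : MeasurableSet {x : Round K | (x.1, (x.2 x.winner).1) ∈ B} :=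
    (measurable_fst.prodMk measurable_winnerSNR.fst) hB
  have hH : ∀ i, Integrable (fun z : ℝ × ℝ × ℝ => ∫ g, h i (z.1, g) ∂(rsuLaw N i)) (snrLaw N i) :=
    fun i => (Integrable.integral_prod_left (hh i)).comp_fst _
  -- This formula is applied both to `h` and to its mean over the RSU links. The resulting inner
  -- integrals agree, because averaging a constant against the probability measure `rsuLaw` changes
  -- nothing.
  have key : ∀ k : Fin K → ℝ × ℝ × ℝ → ℝ, (∀ i, Integrable (k i) (snrLaw N i)) →
      ∫ x, {x : Round K | (x.1, (x.2 x.winner).1) ∈ B}.indicator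
        (fun x => k x.winner (x.2 x.winner)) x ∂(roundLaw N)
      = ∫ s, ∫ γ, {γ | (s, γ) ∈ B}.indicator
        (fun γ => ∫ g, k (slotsWinner s) (γ, g) ∂(rsuLaw N (slotsWinner s))) γ
          ∂(expMeasure (N.meanSNR (slotsWinner s))⁻¹) ∂(slotsLaw N) := by
    intro k hk
    have hint := (integrable_winner N hk).indicator hB'
    unfold roundLaw at hint ⊢
    rw [integral_prod _ hint]
    refine integral_congr_ae (ae_of_all _ fun s => ?_)
    set i := slotsWinner s with hi
    have hBs : MeasurableSet {z : ℝ × ℝ × ℝ | (s, z.1) ∈ B} :=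
      (measurable_const.prodMk measurable_fst) hB
    have hki := (hk i).indicator hBs
    -- Once the slots `s` are fixed, the winner is the fixed pair `i`, and only its coordinate of
    -- the product law matters.
    have h1 : ∫ y, {z : ℝ × ℝ × ℝ | (s, z.1) ∈ B}.indicator (k i) (y i)
        ∂(Measure.pi fun i => snrLaw N i)
        = ∫ z, {z : ℝ × ℝ × ℝ | (s, z.1) ∈ B}.indicator (k i) z ∂(snrLaw N i) := by
      have hmp := measurePreserving_eval (fun i => snrLaw N i) i
      rw [← hmp.map_eq] at hki ⊢
      exact (integral_map hmp.measurable.aemeasurable hki.aestronglyMeasurable).symm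
    refine Eq.trans ?_ (h1.trans ?_)
    · rfl
    · unfold snrLaw at hki ⊢
      rw [integral_prod _ hki]
      refine integral_congr_ae (ae_of_all _ fun γ => ?_)
      by_cases hγ : (s, γ) ∈ B
      · simp [Set.indicator, hγ, ← hi]
      · simp [Set.indicator, hγ]
  rw [key h hh, key _ hH]
  simp

end Winner

lemma Network.τ₁_pos (N : Network K) : 0 < N.τ₁ := add_pos N.τR_pos N.τC_pos

lemma Network.τd₁_pos (N : Network K) : 0 < N.τd₁ := sub_pos.2 N.probe_lt

lemma Network.τd_pos (N : Network K) : 0 < N.τd := N.τ₁_pos.trans N.probe_lt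

/-! ### The optimality equation -/

section Bellman

variable [NeZero K]

lemma integrable_probeReward_winner (N : Network K) (lam : ℝ) :
    Integrable (fun x : Round K =>
      probeReward N lam (x.2 x.winner).1 (x.2 x.winner).2.1 (x.2 x.winner).2.2) (roundLaw N) :=
  integrable_winner N (h := fun _ z => probeReward N lam z.1 z.2.1 z.2.2)
    fun i => integrable_probeReward_snrLaw N i lam

lemma integrable_W_winner (N : Network K) (lam : ℝ) :
    Integrable (fun x : Round K => W N x.winner (x.2 x.winner).1 lam) (roundLaw N) :=
  integrable_winner N (h := fun i z => W N i z.1 lam) fun i => integrable_W N i lam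

lemma integrable_rateD_winner (N : Network K) :
    Integrable (fun x : Round K => rateD (x.2 x.winner).1) (roundLaw N) :=
  integrable_winner N (h := fun _ z => rateD z.1) fun i => integrable_rateD_snrLaw N i

lemma integrable_rateR_winner (N : Network K) :
    Integrable (fun x : Round K =>
      rateR (x.2 x.winner).1 (x.2 x.winner).2.1 (x.2 x.winner).2.2) (roundLaw N) :=
  integrable_winner N (h := fun _ z => rateR z.1 z.2.1 z.2.2) fun i => integrable_rateR_snrLaw N i

/-- `W` is the conditional expectation of the reward of probing. -/
lemma condExp_probeReward (N : Network K) (lam : ℝ) :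
    condExp (MeasurableSpace.comap
        (fun x : Round K => (x.winner, (x.2 x.winner).1)) inferInstance) (roundLaw N)
      (fun x => probeReward N lam (x.2 x.winner).1 (x.2 x.winner).2.1 (x.2 x.winner).2.2)
    =ᵐ[roundLaw N] fun x => W N x.winner (x.2 x.winner).1 lam := by
  have hZ : Measurable fun x : Round K => (x.winner, (x.2 x.winner).1) :=
    measurable_winner.prodMk measurable_winnerSNR.fst
  refine (ae_eq_condExp_of_forall_setIntegral_eq hZ.comap_le
    (integrable_probeReward_winner N lam)
    (fun s _ _ => (integrable_W_winner N lam).integrableOn) ?_ ?_).symm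
  · rintro s ⟨t, ht, rfl⟩ -
    rw [← integral_indicator (hZ ht), ← integral_indicator (hZ ht)]
    have hw : Measurable (slotsWinner (K := K)) :=
      measurable_winner.comp (measurable_id.prodMk measurable_const)
    -- An event about the winner and its V2V SNR is an event about the slots and this SNR, since the
    -- winner is a function of the slots.
    have hB : MeasurableSet {p : (ℕ → Slot K) × ℝ | (slotsWinner p.1, p.2) ∈ t} :=
      ((hw.comp measurable_fst).prodMk measurable_snd) ht
    exact (integral_indicator_winner N (h := fun _ z => probeReward N lam z.1 z.2.1 z.2.2)
      (fun i => integrable_probeReward_snrLaw N i lam) hB).symm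
  · have h := (measurable_W_uncurry N lam).comp
      (comap_measurable fun x : Round K => (x.winner, (x.2 x.winner).1))
    exact h.stronglyMeasurable.aestronglyMeasurable

lemma integrable_bellmanReward (N : Network K) (lam : ℝ) :
    Integrable (bellmanReward N lam) (roundLaw N) :=
  (((integrable_rateD_winner N).const_mul _).sub (integrable_const _)).sup
    ((integrable_const _).sup (integrable_W_winner N lam))

lemma bellmanReward_integral_anti (N : Network K) :
    Antitone fun lam => ∫ x, bellmanReward N lam x ∂(roundLaw N) := by
  intro lam lam' h
  refine integral_mono_ae (integrable_bellmanReward N _) (integrable_bellmanReward N _) ?_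
  filter_upwards [ae_pos_winner N] with x hx
  unfold bellmanReward
  exact max_le_max (sub_le_sub_left (mul_le_mul_of_nonneg_right h N.τd_pos.le) _)
    (max_le_max le_rfl (W_anti N _ hx.1.le h))

/-- Raising the price by `d` lowers the value of transmitting by `τd * d`, that of probing by at
most as much, and that of re-contending not at all. -/
lemma bellmanReward_integral_le_add (N : Network K) {lam lam' : ℝ} (h : lam ≤ lam') :
    ∫ x, bellmanReward N lam x ∂(roundLaw N)
      ≤ ∫ x, bellmanReward N lam' x ∂(roundLaw N) + N.τd * (lam' - lam) := by
  have h1 : ∫ x, bellmanReward N lam x ∂(roundLaw N)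
      ≤ ∫ x, (bellmanReward N lam' x + N.τd * (lam' - lam)) ∂(roundLaw N) := by
    refine integral_mono_ae (integrable_bellmanReward N _)
      ((integrable_bellmanReward N _).add (integrable_const _)) ?_
    filter_upwards [ae_pos_winner N] with x hx
    have hW := W_le_add N x.winner hx.1.le h
    have hd := mul_nonneg N.τd_pos.le (sub_nonneg.2 h)
    unfold bellmanReward
    rw [max_add, max_add]
    exact max_le_max (by linarith) (max_le_max (by linarith) (by linarith))
  rwa [integral_add (integrable_bellmanReward N _) (integrable_const _), integral_const,
    probReal_univ, one_smul] at h1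

lemma continuous_bellmanReward_integral (N : Network K) :
    Continuous fun lam => ∫ x, bellmanReward N lam x ∂(roundLaw N) := by
  refine (LipschitzWith.of_le_add_mul ⟨N.τd, N.τd_pos.le⟩ fun a b => ?_).continuous
  have hd : 0 ≤ N.τd * dist a b := mul_nonneg N.τd_pos.le dist_nonneg
  rcases le_total a b with h | h
  · refine (bellmanReward_integral_le_add N h).trans_eq ?_
    rw [dist_comm, Real.dist_eq, abs_of_nonneg (sub_nonneg.2 h)]
    rfl
  · exact (bellmanReward_integral_anti N h).trans (le_add_of_nonneg_right hd)

lemma bellmanReward_integral_zero_pos (N : Network K) :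
    0 < ∫ x, bellmanReward N 0 x ∂(roundLaw N) := by
  have hpos : ∀ᵐ x ∂(roundLaw N), 0 < bellmanReward N 0 x := by
    filter_upwards [ae_pos_winner N] with x hx
    refine lt_of_lt_of_le ?_ (le_max_left _ _)
    simpa using mul_pos N.τd_pos (rateD_pos hx.1)
  rw [integral_pos_iff_support_of_nonneg_ae (hpos.mono fun x hx => hx.le)
    (integrable_bellmanReward N 0)]
  have : (Function.support (bellmanReward N 0) : Set (Round K)) =ᵐ[roundLaw N] Set.univ := by
    rw [eventuallyEq_univ]
    exact hpos.mono fun x hx => hx.ne'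
  rw [measure_congr this]
  simp

/-- The optimality equation has exactly one solution, and this solution is positive. -/
lemma exists_bellmanEquation_iff (N : Network K) :
    ∃ lam : ℝ, 0 < lam ∧ ∀ μ : ℝ, BellmanEquation N μ ↔ μ = lam := by
  set F : ℝ → ℝ := fun lam => ∫ x, bellmanReward N lam x ∂(roundLaw N) with hF
  have hanti : StrictAnti fun lam => F lam - lam * N.τo := fun a b h => by
    have h1 := bellmanReward_integral_anti N h.le
    have h2 := mul_lt_mul_of_pos_right h N.τo_pos
    simp only [hF] at *
    linarith
  have hcont : Continuous fun lam => F lam - lam * N.τo :=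
    (continuous_bellmanReward_integral N).sub (continuous_id.mul continuous_const)
  have h0 : 0 < F 0 := bellmanReward_integral_zero_pos N
  -- `F 0 / τo` is an upper end for the root: `F` is antitone, so its value there is at most `F 0`,
  -- which is the right-hand side of the equation at this point.
  have hb : 0 ≤ F 0 / N.τo := div_nonneg h0.le N.τo_pos.le
  have hFb : F (F 0 / N.τo) - F 0 / N.τo * N.τo ≤ 0 := by
    rw [div_mul_cancel₀ _ N.τo_pos.ne']
    exact sub_nonpos.2 (bellmanReward_integral_anti N hb)
  obtain ⟨lam, hlam, hlam0⟩ := intermediate_value_Icc' hb hcont.continuousOn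
    (show (0 : ℝ) ∈ Set.Icc _ _ from ⟨hFb, by simpa using h0.le⟩)
  refine ⟨lam, lt_of_le_of_ne hlam.1 ?_, fun μ => ⟨fun h => ?_, ?_⟩⟩
  · rintro rfl
    simp only [zero_mul, sub_zero] at hlam0
    exact h0.ne' hlam0
  · refine hanti.injective ?_
    simp only at hlam0 ⊢
    rw [hlam0]
    exact sub_eq_zero.2 h
  · rintro rfl
    exact sub_eq_zero.1 hlam0

end Bellman

/-! ### Gain of one round -/

instance : MeasurableSingletonClass FirstAction := ⟨fun _ => trivial⟩

instance : MeasurableSingletonClass SecondAction := ⟨fun _ => trivial⟩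

instance : Countable FirstAction :=
  ⟨⟨fun a => match a with | .transmit => 0 | .recontend => 1 | .probe => 2,
    fun a b h => by cases a <;> cases b <;> simp_all⟩⟩

instance : Countable SecondAction :=
  ⟨⟨fun a => match a with | .transmit => 0 | .recontend => 1,
    fun a b h => by cases a <;> cases b <;> simp_all⟩⟩

/-- The reward collected in a round with decisions `a`, `b` and SNRs `z` of the winner. -/
noncomputable def roundReward (N : Network K) (z : ℝ × ℝ × ℝ) : FirstAction → SecondAction → ℝ
  | .transmit, _ => N.τd * rateD z.1
  | .probe, .transmit => N.τd₁ * max (rateD z.1) (rateR z.1 z.2.1 z.2.2)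
  | _, _ => 0

/-- The time spent in a round with decisions `a`, `b` after the contention. -/
noncomputable def roundTime (N : Network K) : FirstAction → SecondAction → ℝ
  | .transmit, _ => N.τd
  | .probe, .transmit => N.τd
  | .probe, .recontend => N.τ₁
  | .recontend, _ => 0

lemma roundTime_nonneg (N : Network K) (a : FirstAction) (b : SecondAction) :
    0 ≤ roundTime N a b := by
  cases a <;> cases b <;> simp [roundTime, N.τd_pos.le, N.τ₁_pos.le]

lemma roundTime_le (N : Network K) (a : FirstAction) (b : SecondAction) :
    roundTime N a b ≤ N.τd := by
  have : N.τ₁ ≤ N.τd := N.probe_lt.le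
  cases a <;> cases b <;> simp [roundTime, N.τd_pos.le, this]

lemma abs_roundReward_le (N : Network K) (z : ℝ × ℝ × ℝ) (a : FirstAction) (b : SecondAction) :
    |roundReward N z a b| ≤ N.τd * (|rateD z.1| + |rateR z.1 z.2.1 z.2.2|) := by
  have h1 : N.τd₁ ≤ N.τd := sub_le_self _ N.τ₁_pos.le
  have h2 := N.τd_pos
  have h3 := N.τd₁_pos
  have h4 : |max (rateD z.1) (rateR z.1 z.2.1 z.2.2)|
      ≤ |rateD z.1| + |rateR z.1 z.2.1 z.2.2| :=
    abs_max_le_max_abs_abs.trans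
      (max_le_add_of_nonneg (abs_nonneg _) (abs_nonneg _))
  have h5 : 0 ≤ N.τd * (|rateD z.1| + |rateR z.1 z.2.1 z.2.2|) := by positivity
  have h6 : |N.τd * rateD z.1| ≤ N.τd * (|rateD z.1| + |rateR z.1 z.2.1 z.2.2|) := by
    rw [abs_mul, abs_of_pos h2]
    exact mul_le_mul_of_nonneg_left (le_add_of_nonneg_right (abs_nonneg _)) h2.le
  have h7 : |N.τd₁ * max (rateD z.1) (rateR z.1 z.2.1 z.2.2)|
      ≤ N.τd * (|rateD z.1| + |rateR z.1 z.2.1 z.2.2|) := by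
    rw [abs_mul, abs_of_pos h3]
    exact mul_le_mul h1 h4 (abs_nonneg _) h2.le
  cases a <;> cases b <;> simp only [roundReward, abs_zero, h5, h6, h7]

lemma measurable_roundReward (N : Network K) :
    Measurable fun p : FirstAction × SecondAction × (ℝ × ℝ × ℝ) =>
      roundReward N p.2.2 p.1 p.2.1 := by
  have h1 := measurable_rateD.comp (measurable_fst : Measurable fun z : ℝ × ℝ × ℝ => z.1)
  refine measurable_from_prod_countable_right fun a => measurable_from_prod_countable_right
    fun b => ?_
  cases a <;> cases b <;> simp only [roundReward]
  exacts [h1.const_mul _, h1.const_mul _, measurable_const, measurable_const,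
    (h1.max measurable_rateR).const_mul _, measurable_const]

lemma measurable_roundTime (N : Network K) :
    Measurable fun p : FirstAction × SecondAction => roundTime N p.1 p.2 :=
  measurable_of_countable _

/-- Gain after the first decision if the second decision is optimal at the price `lam`. -/
noncomputable def firstGain (N : Network K) (lam : ℝ) (z : ℝ × ℝ × ℝ) : FirstAction → ℝ
  | .transmit => N.τd * rateD z.1 - lam * N.τd
  | .recontend => 0
  | .probe => probeReward N lam z.1 z.2.1 z.2.2

/-- Expected gain after the first decision if the second decision is optimal. -/
noncomputable def firstMeanGain (N : Network K) (lam : ℝ) (i : Fin K) (γ : ℝ) : FirstAction → ℝ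
  | .transmit => N.τd * rateD γ - lam * N.τd
  | .recontend => 0
  | .probe => W N i γ lam

/-- After a probe, each of the two second decisions yields one entry of the maximum in
`probeReward`; without a probe the second decision has no effect. -/
lemma roundReward_sub_le_firstGain (N : Network K) (lam : ℝ) (z : ℝ × ℝ × ℝ) (a : FirstAction)
    (b : SecondAction) :
    roundReward N z a b - lam * roundTime N a b ≤ firstGain N lam z a := by
  cases a <;> cases b <;> simp [roundReward, roundTime, firstGain, probeReward]

lemma roundReward_sub_eq_firstGain (N : Network K) (lam : ℝ) (o : FirstObs K) (g : SecondObs)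
    (a : FirstAction) (k : ℕ) (h : Fin k → RoundRecord K) :
    roundReward N (o.2.2, g) a ((rpca N lam).second k h o g)
        - lam * roundTime N a ((rpca N lam).second k h o g)
      = firstGain N lam (o.2.2, g) a := by
  have h3 := N.τd₁_pos
  -- By this identity, `τd₁ * R - lam * τd ≥ -lam * τ₁` amounts to `R ≥ lam`, which is the test made
  -- by RPCA after probing.
  have h4 : N.τd = N.τ₁ + N.τd₁ := by simp [Network.τd₁]
  simp only [rpca]
  split_ifs with hc
  · cases a <;> simp only [roundReward, roundTime, firstGain, probeReward]
    · simp
    · have h5 := mul_le_mul_of_nonneg_left hc h3.le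
      rw [max_eq_left (a := _ - _)]
      rw [h4]
      linarith
  · cases a <;> simp only [roundReward, roundTime, firstGain, probeReward]
    · simp
    · have h5 := mul_le_mul_of_nonneg_left (not_le.1 hc).le h3.le
      rw [max_eq_right (a := _ - _)]
      · simp
      rw [h4]
      linarith

lemma integrable_roundTime (N : Network K) {a : Round K → FirstAction}
    {b : Round K → SecondAction} (ha : Measurable a) (hb : Measurable b) :
    Integrable (fun x => roundTime N (a x) (b x)) (roundLaw N) :=
  (integrable_const N.τd).mono'
    ((measurable_roundTime N).comp (ha.prodMk hb)).aestronglyMeasurable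
    (ae_of_all _ fun x => by
      rw [Real.norm_of_nonneg (roundTime_nonneg N _ _)]
      exact roundTime_le N _ _)

lemma measurable_rpca_first (N : Network K) (lam : ℝ) :
    Measurable fun o : FirstObs K => (rpca N lam).first 0 Fin.elim0 o := by
  classical
  have hW : Measurable fun o : FirstObs K => W N o.2.1 o.2.2 lam :=
    (measurable_W_uncurry N lam).comp measurable_snd
  have hr : Measurable fun o : FirstObs K => N.τd * rateD o.2.2 - lam * N.τd :=
    ((measurable_rateD.comp measurable_snd.snd).const_mul _).sub_const _
  exact Measurable.ite (measurableSet_le (hW.max measurable_const) hr) measurable_const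
    (Measurable.ite ((measurableSet_lt hr measurable_const).inter
      (measurableSet_lt hW measurable_const)) measurable_const measurable_const)

lemma measurable_rpca_second (N : Network K) (lam : ℝ) :
    Measurable fun p : FirstObs K × SecondObs => (rpca N lam).second 0 Fin.elim0 p.1 p.2 := by
  classical
  have h1 : Measurable fun p : FirstObs K × SecondObs => (p.1.2.2, p.2) :=
    measurable_fst.snd.snd.prodMk measurable_snd
  exact Measurable.ite (measurableSet_le measurable_const
    ((measurable_rateD.comp h1.fst).max (measurable_rateR.comp h1))) measurable_const
    measurable_const

section Gain

variable [NeZero K]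

lemma firstMeanGain_le_bellmanReward (N : Network K) (lam : ℝ) (x : Round K) (a : FirstAction) :
    firstMeanGain N lam x.winner (x.2 x.winner).1 a ≤ bellmanReward N lam x := by
  cases a <;> simp [firstMeanGain, bellmanReward]

lemma firstMeanGain_eq_bellmanReward (N : Network K) (lam : ℝ) (x : Round K) (k : ℕ)
    (h : Fin k → RoundRecord K) :
    firstMeanGain N lam x.winner (x.2 x.winner).1 ((rpca N lam).first k h (firstObs N x))
      = bellmanReward N lam x := by
  simp only [rpca, firstObs, bellmanReward]
  set r := N.τd * rateD (x.2 x.winner).1 - lam * N.τd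
  set w := W N x.winner (x.2 x.winner).1 lam
  split_ifs with h1 h2
  · simp only [firstMeanGain]
    rw [max_comm 0 w, max_eq_left h1]
  · simp only [firstMeanGain]
    rw [max_eq_left h2.2.le, max_eq_right h2.1.le]
  · simp only [firstMeanGain]
    rw [not_le] at h1
    -- If `w` were negative, not transmitting would mean `r < 0`, and the rule would have chosen to
    -- re-contend.
    have h3 : 0 ≤ w := by
      by_contra hneg
      rw [not_le] at hneg
      rw [max_eq_right hneg.le] at h1
      exact h2 ⟨h1, hneg⟩
    rw [max_eq_left h3] at h1
    rw [max_eq_right h3, max_eq_right h1.le]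

/-- The gain of a round at the price `lam` per unit of time. -/
noncomputable def roundGain (N : Network K) (lam : ℝ) (a : FirstAction) (b : SecondAction)
    (x : Round K) : ℝ :=
  roundReward N (x.2 x.winner) a b - lam * (contentionTime N x + roundTime N a b)

/-- The event of probing is determined by the slots and the V2V SNR of the winner. On it the RSU
links can therefore be integrated out, which turns `probeReward` into `W`; the other two actions
have the same gain on both sides. -/
lemma integral_firstGain (N : Network K) (lam : ℝ) {act : FirstObs K → FirstAction}
    (hact : Measurable act) :
    Integrable (fun x => firstGain N lam (x.2 x.winner) (act (firstObs N x))) (roundLaw N) ∧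
    Integrable (fun x => firstMeanGain N lam x.winner (x.2 x.winner).1 (act (firstObs N x)))
      (roundLaw N) ∧
    ∫ x, firstGain N lam (x.2 x.winner) (act (firstObs N x)) ∂(roundLaw N)
      = ∫ x, firstMeanGain N lam x.winner (x.2 x.winner).1 (act (firstObs N x))
          ∂(roundLaw N) := by
  classical
  -- Contention time and winner depend on the slots only, so the SNRs put in here are dummies.
  set B : Set ((ℕ → Slot K) × ℝ) := {p | act (contentionTime N (p.1, fun _ => 0),
    slotsWinner p.1, p.2) = .probe}
  have hw : Measurable (slotsWinner (K := K)) :=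
    measurable_winner.comp (measurable_id.prodMk measurable_const)
  have hc : Measurable fun s : ℕ → Slot K => contentionTime N (s, fun _ => 0) :=
    (measurable_contentionTime N).comp (measurable_id.prodMk measurable_const)
  have hB : MeasurableSet B :=
    (hact.comp ((hc.comp measurable_fst).prodMk
      ((hw.comp measurable_fst).prodMk measurable_snd))) (MeasurableSet.singleton FirstAction.probe)
  set E : Set (Round K) := {x | (x.1, (x.2 x.winner).1) ∈ B}
  have hEmem : ∀ x, x ∈ E ↔ act (firstObs N x) = .probe := fun x => Iff.rfl
  have hEm : MeasurableSet E := (measurable_fst.prodMk measurable_winnerSNR.fst) hB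
  set D : Set (Round K) := {x | act (firstObs N x) = .transmit} with hD
  have hDm : MeasurableSet D :=
    (hact.comp (measurable_firstObs N)) (MeasurableSet.singleton FirstAction.transmit)
  have hr : Integrable (D.indicator fun x : Round K =>
      N.τd * rateD (x.2 x.winner).1 - lam * N.τd) (roundLaw N) :=
    (((integrable_rateD_winner N).const_mul _).sub (integrable_const _)).indicator hDm
  have hp := (integrable_probeReward_winner N lam).indicator hEm
  have hW := (integrable_W_winner N lam).indicator hEm
  have e1 : (fun x => firstGain N lam (x.2 x.winner) (act (firstObs N x)))
      = fun x => D.indicator (fun x : Round K =>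
          N.τd * rateD (x.2 x.winner).1 - lam * N.τd) x
        + E.indicator (fun x : Round K =>
          probeReward N lam (x.2 x.winner).1 (x.2 x.winner).2.1 (x.2 x.winner).2.2) x := by
    funext x
    simp only [Set.indicator, hEmem, hD, Set.mem_ofPred_eq]
    cases act (firstObs N x) <;> simp [firstGain]
  have e2 : (fun x => firstMeanGain N lam x.winner (x.2 x.winner).1 (act (firstObs N x)))
      = fun x => D.indicator (fun x : Round K =>
          N.τd * rateD (x.2 x.winner).1 - lam * N.τd) x
        + E.indicator (fun x : Round K => W N x.winner (x.2 x.winner).1 lam) x := by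
    funext x
    simp only [Set.indicator, hEmem, hD, Set.mem_ofPred_eq]
    cases act (firstObs N x) <;> simp [firstMeanGain]
  rw [e1, e2]
  refine ⟨hr.add hp, hr.add hW, ?_⟩
  rw [integral_add hr hp, integral_add hr hW]
  congr 1
  exact integral_indicator_winner N (h := fun _ z => probeReward N lam z.1 z.2.1 z.2.2)
    (fun i => integrable_probeReward_snrLaw N i lam) hB

/-- An integrable bound for the rewards of a round. -/
noncomputable def rewardBound (N : Network K) (x : Round K) : ℝ :=
  N.τd * (|rateD (x.2 x.winner).1| + |rateR (x.2 x.winner).1 (x.2 x.winner).2.1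
    (x.2 x.winner).2.2|)

lemma integrable_rewardBound (N : Network K) : Integrable (rewardBound N) (roundLaw N) :=
  ((integrable_rateD_winner N).abs.add (integrable_rateR_winner N).abs).const_mul _

variable (N : Network K) (lam : ℝ) {a : Round K → FirstAction} {b : Round K → SecondAction}

lemma integrable_roundReward (ha : Measurable a) (hb : Measurable b) :
    Integrable (fun x => roundReward N (x.2 x.winner) (a x) (b x)) (roundLaw N) :=
  (integrable_rewardBound N).mono'
    ((measurable_roundReward N).comp
      (ha.prodMk (hb.prodMk measurable_winnerSNR))).aestronglyMeasurable
    (ae_of_all _ fun _ => abs_roundReward_le N _ _ _)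

lemma integrable_roundGain (ha : Measurable a) (hb : Measurable b) :
    Integrable (fun x => roundGain N lam (a x) (b x) x) (roundLaw N) :=
  (integrable_roundReward N ha hb).sub
    (((integrable_contentionTime N).add (integrable_roundTime N ha hb)).const_mul lam)

variable {act : FirstObs K → FirstAction} {act₂ : FirstObs K → SecondObs → SecondAction}

lemma roundGain_eq (a : FirstAction) (b : SecondAction) (x : Round K) :
    roundGain N lam a b x = (roundReward N (x.2 x.winner) a b - lam * roundTime N a b)
      - lam * contentionTime N x := by
  unfold roundGain
  ring

/-- At the price `lam`, no decision rule gains more on average than the right-hand side. -/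
lemma integral_roundGain_le (h : Measurable act)
    (h₂ : Measurable fun p : FirstObs K × SecondObs => act₂ p.1 p.2) :
    ∫ x, roundGain N lam (act (firstObs N x)) (act₂ (firstObs N x) (secondObs x)) x ∂(roundLaw N)
      ≤ ∫ x, bellmanReward N lam x ∂(roundLaw N) - lam * N.τo := by
  have hi := integral_firstGain N lam h
  have hct := (integrable_contentionTime N).const_mul lam
  have h1 : ∫ x, roundGain N lam (act (firstObs N x)) (act₂ (firstObs N x) (secondObs x)) x
        ∂(roundLaw N)
      ≤ ∫ x, (firstGain N lam (x.2 x.winner) (act (firstObs N x)) - lam * contentionTime N x)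
        ∂(roundLaw N) := by
    refine integral_mono (integrable_roundGain N lam (h.comp (measurable_firstObs N))
      (h₂.comp ((measurable_firstObs N).prodMk measurable_secondObs))) (hi.1.sub hct) fun x => ?_
    simp only [roundGain_eq]
    exact sub_le_sub_right (roundReward_sub_le_firstGain N lam _ _ _) _
  rw [integral_sub hi.1 hct, integral_const_mul, integral_contentionTime, hi.2.2] at h1
  refine h1.trans (sub_le_sub_right ?_ _)
  exact integral_mono hi.2.1 (integrable_bellmanReward N lam) fun x =>
    firstMeanGain_le_bellmanReward N lam x _

/-- Both estimates behind `integral_roundGain_le` are equalities for RPCA: its second decision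
attains the maximum in `probeReward`, its first one the maximum in `bellmanReward`. -/
lemma integral_roundGain_rpca :
    ∫ x, roundGain N lam ((rpca N lam).first 0 Fin.elim0 (firstObs N x))
        ((rpca N lam).second 0 Fin.elim0 (firstObs N x) (secondObs x)) x ∂(roundLaw N)
      = ∫ x, bellmanReward N lam x ∂(roundLaw N) - lam * N.τo := by
  have hi := integral_firstGain N lam (measurable_rpca_first N lam)
  have hct := (integrable_contentionTime N).const_mul lam
  simp only [roundGain_eq]
  have h1 : ∀ x : Round K, roundReward N (x.2 x.winner)
      ((rpca N lam).first 0 Fin.elim0 (firstObs N x))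
        ((rpca N lam).second 0 Fin.elim0 (firstObs N x) (secondObs x))
      - lam * roundTime N ((rpca N lam).first 0 Fin.elim0 (firstObs N x))
        ((rpca N lam).second 0 Fin.elim0 (firstObs N x) (secondObs x))
      = firstGain N lam (x.2 x.winner) ((rpca N lam).first 0 Fin.elim0 (firstObs N x)) := fun x =>
    roundReward_sub_eq_firstGain N lam (firstObs N x) (secondObs x) _ 0 _
  simp only [h1]
  rw [integral_sub hi.1 hct, integral_const_mul, integral_contentionTime, hi.2.2]
  simp only [firstMeanGain_eq_bellmanReward]

end Gain

/-! ### The course of a strategy -/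

lemma measurable_time_round (N : Network K) : Measurable fun p : FirstAction × SecondAction × Round K =>
    contentionTime N p.2.2 + roundTime N p.1 p.2.1 :=
  ((measurable_contentionTime N).comp measurable_snd.snd).add
    ((measurable_roundTime N).comp (measurable_fst.prodMk measurable_snd.fst))

lemma abs_time_round_le (N : Network K) (a : FirstAction) (b : SecondAction) (x : Round K) :
    |contentionTime N x + roundTime N a b| ≤ contentionTime N x + N.τd := by
  have h1 := le_contentionTime N x
  have h2 := roundTime_nonneg N a b
  have h3 := roundTime_le N a b
  have h4 := add_pos N.τR_pos N.τC_pos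
  rw [abs_of_nonneg (by linarith)]
  linarith

section Course

variable [NeZero K] (N : Network K) (S : Strategy K)

/-- The strategy has not stopped before round `l`. -/
def alive (l : ℕ) : Set (Path K) := {ω | ∀ j < l, ¬ StopsAt N S ω j}

/-- The case `k = l` is included, because the history available in round `l` is made of the rounds
before `l`. This makes decisions in round `l` a rule fixed by the past and applied to fresh
observations. -/
lemma history_update (ω : Path K) (l : ℕ) (y : Round K) {k : ℕ} (hk : k ≤ l) :
    history N S (Function.update ω l y) k = history N S ω k := by
  induction k with
  | zero => rfl
  | succ k ih =>
    have hkl : k ≠ l := by omega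
    simp only [history]
    rw [ih (by omega), Function.update_of_ne hkl]

lemma stopsAt_update (ω : Path K) {l : ℕ} (y : Round K) {j : ℕ} (hj : j < l) :
    StopsAt N S (Function.update ω l y) j ↔ StopsAt N S ω j := by
  simp only [StopsAt, firstDecision, secondDecision, history_update N S ω l y hj.le,
    Function.update_of_ne hj.ne]

lemma update_mem_alive (ω : Path K) (l : ℕ) (y : Round K) :
    Function.update ω l y ∈ alive N S l ↔ ω ∈ alive N S l :=
  forall₂_congr fun _ hj => not_congr (stopsAt_update N S ω y hj)

variable {N S}

lemma measurable_recordOf :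
    Measurable fun p : FirstAction × Round K => recordOf N p.2 p.1 := by
  refine measurable_from_prod_countable_right fun a => ?_
  cases a <;> simp only [recordOf]
  exacts [(measurable_firstObs N).prodMk measurable_const,
    (measurable_firstObs N).prodMk measurable_const,
    (measurable_firstObs N).prodMk (measurable_const.prodMk measurable_secondObs)]

lemma measurable_history (hS : S.IsMeasurable) (k : ℕ) :
    Measurable fun ω => history N S ω k := by
  induction k with
  | zero => exact measurable_const
  | succ k ih =>
    have hx : Measurable fun ω : Path K => ω k := measurable_pi_apply k
    have h1 : Measurable fun ω => S.first k (history N S ω k) (firstObs N (ω k)) :=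
      (hS.first k).comp (ih.prodMk ((measurable_firstObs N).comp hx))
    refine measurable_pi_iff.2 fun i => ?_
    simp only [history]
    refine Fin.lastCases ?_ (fun j => ?_) i
    · simp only [Fin.snoc_last]
      exact measurable_recordOf.comp (h1.prodMk hx)
    · simp only [Fin.snoc_castSucc]
      exact measurable_pi_iff.1 ih j

lemma measurable_firstDecision (hS : S.IsMeasurable) (k : ℕ) :
    Measurable fun ω => firstDecision N S ω k :=
  (hS.first k).comp ((measurable_history hS k).prodMk
    ((measurable_firstObs N).comp (measurable_pi_apply k)))

lemma measurable_secondDecision (hS : S.IsMeasurable) (k : ℕ) :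
    Measurable fun ω => secondDecision N S ω k :=
  (hS.second k).comp ((measurable_history hS k).prodMk
    (((measurable_firstObs N).comp (measurable_pi_apply k)).prodMk
      (measurable_secondObs.comp (measurable_pi_apply k))))

lemma measurableSet_stopsAt (hS : S.IsMeasurable) (k : ℕ) :
    MeasurableSet {ω | StopsAt N S ω k} :=
  ((measurable_firstDecision hS k) (MeasurableSet.singleton FirstAction.transmit)).union
    (((measurable_firstDecision hS k) (MeasurableSet.singleton FirstAction.probe)).inter
      ((measurable_secondDecision hS k) (MeasurableSet.singleton SecondAction.transmit)))

lemma measurableSet_alive (hS : S.IsMeasurable) (l : ℕ) : MeasurableSet (alive N S l) := by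
  have h : alive N S l = ⋂ j ∈ Finset.range l, {ω | StopsAt N S ω j}ᶜ := by
    ext ω; simp [alive]
  rw [h]
  exact Finset.measurableSet_biInter _ fun j _ => (measurableSet_stopsAt hS j).compl

/-- The stopping round itself counts as alive, hence the `+ 1`. Without a stopping round `stopRound`
would take the default value `0`. -/
lemma mem_alive_iff {ω : Path K} (h : ∃ k, StopsAt N S ω k) (l : ℕ) :
    ω ∈ alive N S l ↔ l < stopRound N S ω + 1 := by
  have hmem : StopsAt N S ω (stopRound N S ω) := Nat.sInf_mem (s := {k | StopsAt N S ω k}) h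
  constructor
  · intro hl
    by_contra hc
    exact hl _ (by omega) hmem
  · exact fun hl j hj => Nat.notMem_of_lt_sInf (lt_of_lt_of_le hj (Nat.lt_succ_iff.1 hl))

/-- `roundReward` vanishes unless the decisions stop the strategy, so only the last term survives.
-/
lemma reward_eq_sum {ω : Path K} (h : ∃ k, StopsAt N S ω k) :
    reward N S ω = ∑ l ∈ Finset.range (stopRound N S ω + 1),
      roundReward N ((ω l).2 (ω l).winner) (firstDecision N S ω l) (secondDecision N S ω l) := by
  have hmem : StopsAt N S ω (stopRound N S ω) := Nat.sInf_mem (s := {k | StopsAt N S ω k}) h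
  rw [Finset.sum_range_succ, Finset.sum_eq_zero, zero_add]
  · unfold reward
    rcases hmem with h1 | ⟨h1, h2⟩
    · simp [h1, roundReward, firstObs]
    · simp [h1, h2, roundReward, firstObs, secondObs]
  · intro l hl
    have hl' : ¬ StopsAt N S ω l := Nat.notMem_of_lt_sInf (Finset.mem_range.1 hl)
    unfold StopsAt at hl'
    cases ha : firstDecision N S ω l <;> cases hb : secondDecision N S ω l <;>
      simp_all [roundReward]

/-- A probe before the stopping round is followed by re-contention and costs `τ₁`; in the stopping
round `τd` is due with or without a probe. -/
lemma timeCost_eq_sum {ω : Path K} (h : ∃ k, StopsAt N S ω k) :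
    timeCost N S ω = ∑ l ∈ Finset.range (stopRound N S ω + 1),
      (contentionTime N (ω l)
        + roundTime N (firstDecision N S ω l) (secondDecision N S ω l)) := by
  have hmem : StopsAt N S ω (stopRound N S ω) := Nat.sInf_mem (s := {k | StopsAt N S ω k}) h
  unfold timeCost
  rw [Finset.sum_add_distrib, Finset.sum_range_succ (fun l => roundTime N _ _), add_assoc]
  congr 2
  · refine Finset.sum_congr rfl fun l hl => ?_
    have hl' : ¬ StopsAt N S ω l := Nat.notMem_of_lt_sInf (Finset.mem_range.1 hl)
    unfold StopsAt at hl'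
    cases ha : firstDecision N S ω l <;> cases hb : secondDecision N S ω l <;>
      simp_all [roundTime]
  · rcases hmem with h1 | ⟨h1, h2⟩
    · simp [h1, roundTime]
    · simp [h1, h2, roundTime]

/-- The sum is the mean number of rounds played. Each round lasts at least `τR + τC`, so this number
is bounded by the mean of the time cost divided by `τR + τC`. -/
lemma summable_alive (hS : S.IsFeasible N) :
    Summable fun l => (pathLaw N).real (alive N S l) := by
  have hc : 0 < N.τR + N.τC := add_pos N.τR_pos N.τC_pos
  have hind : ∀ l, Integrable ((alive N S l).indicator fun _ => (1 : ℝ)) (pathLaw N) := fun l =>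
    (integrable_const _).indicator (measurableSet_alive hS.measurable l)
  refine summable_of_sum_range_le (c := ∫ ω, timeCost N S ω / (N.τR + N.τC) ∂(pathLaw N))
    (fun _ => measureReal_nonneg) fun L => ?_
  have h1 : ∑ l ∈ Finset.range L, (pathLaw N).real (alive N S l)
      = ∫ ω, ∑ l ∈ Finset.range L, (alive N S l).indicator (fun _ => (1 : ℝ)) ω
          ∂(pathLaw N) := by
    rw [integral_finsetSum _ fun l _ => hind l]
    refine Finset.sum_congr rfl fun l _ => ?_
    rw [integral_indicator (measurableSet_alive hS.measurable l)]
    simp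
  rw [h1]
  refine integral_mono_ae (integrable_finsetSum _ fun l _ => hind l)
    (hS.integrable_timeCost.div_const _) ?_
  filter_upwards [hS.stops] with ω hω
  have h2 : ∑ l ∈ Finset.range L, (alive N S l).indicator (fun _ => (1 : ℝ)) ω
      ≤ stopRound N S ω + 1 := by
    classical
    simp only [Set.indicator, Finset.sum_ite, Finset.sum_const_zero, add_zero, Finset.sum_const,
      nsmul_eq_mul, mul_one]
    have : (Finset.range L).filter (fun l => ω ∈ alive N S l)
        ⊆ Finset.range (stopRound N S ω + 1) := fun l hl =>
      Finset.mem_range.2 ((mem_alive_iff hω l).1 (Finset.mem_filter.1 hl).2)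
    exact_mod_cast (Finset.card_le_card this).trans_eq (Finset.card_range _)
  refine h2.trans ((le_div_iff₀ hc).2 ?_)
  rw [timeCost_eq_sum hω]
  have h3 := Finset.card_nsmul_le_sum (Finset.range (stopRound N S ω + 1))
    (fun l => contentionTime N (ω l)
      + roundTime N (firstDecision N S ω l) (secondDecision N S ω l)) (N.τR + N.τC)
    fun l _ => le_add_of_le_of_nonneg (le_contentionTime N _) (roundTime_nonneg N _ _)
  rw [Finset.card_range, nsmul_eq_mul, Nat.cast_add_one] at h3
  exact h3

/-- Expectation of a quantity that is added up over the rounds until the strategy stops. -/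
lemma integrable_courseSum (hS : S.IsMeasurable)
    (hends : ∀ᵐ ω ∂(pathLaw N), ∃ k, StopsAt N S ω k)
    (hsum : Summable fun l => (pathLaw N).real (alive N S l))
    {φ : FirstAction → SecondAction → Round K → ℝ}
    (hφ : Measurable fun p : FirstAction × SecondAction × Round K => φ p.1 p.2.1 p.2.2)
    {M : Round K → ℝ} (hM : Integrable M (roundLaw N)) (hφM : ∀ a b x, |φ a b x| ≤ M x) :
    (∀ l, Integrable ((alive N S l).indicator fun ω =>
      φ (firstDecision N S ω l) (secondDecision N S ω l) (ω l)) (pathLaw N)) ∧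
    Integrable (fun ω => ∑ l ∈ Finset.range (stopRound N S ω + 1),
      φ (firstDecision N S ω l) (secondDecision N S ω l) (ω l)) (pathLaw N) ∧
    HasSum (fun l => ∫ ω, (alive N S l).indicator (fun ω =>
        φ (firstDecision N S ω l) (secondDecision N S ω l) (ω l)) ω ∂(pathLaw N))
      (∫ ω, ∑ l ∈ Finset.range (stopRound N S ω + 1),
        φ (firstDecision N S ω l) (secondDecision N S ω l) (ω l) ∂(pathLaw N)) := by
  have hA := fun l => measurableSet_alive (N := N) hS l
  -- Reaching round `l` is independent of round `l`, so the dominating term has mean `P(alive l) *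
  -- E[M]`, which is summable in `l`.
  have hdom := fun l => integral_indicator_eval (roundLaw N) l (hA l)
    (fun ω y => update_mem_alive N S ω l y) hM
  have hle : ∀ l ω, ‖(alive N S l).indicator (fun ω =>
      φ (firstDecision N S ω l) (secondDecision N S ω l) (ω l)) ω‖
      ≤ (alive N S l).indicator (fun ω => M (ω l)) ω := by
    intro l ω
    rw [norm_indicator_eq_indicator_norm]
    exact Set.indicator_le_indicator (hφM _ _ _)
  have hint : ∀ l, Integrable ((alive N S l).indicator fun ω =>
      φ (firstDecision N S ω l) (secondDecision N S ω l) (ω l)) (pathLaw N) := fun l =>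
    (hdom l).1.mono' ((hφ.comp ((measurable_firstDecision hS l).prodMk
      ((measurable_secondDecision hS l).prodMk (measurable_pi_apply l)))).indicator
        (hA l)).aestronglyMeasurable (ae_of_all _ (hle l))
  refine ⟨hint, integrable_randomSum (n := fun ω => stopRound N S ω + 1)
    (f := fun l ω => φ (firstDecision N S ω l) (secondDecision N S ω l) (ω l))
    (hends.mono fun ω hω l => mem_alive_iff hω l) hint ?_⟩
  refine Summable.of_nonneg_of_le (fun l => integral_nonneg fun _ => norm_nonneg _) (fun l => ?_)
    (hsum.mul_right (∫ x, M x ∂(roundLaw N)))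
  exact (integral_mono (hint l).norm (hdom l).1 (hle l)).trans_eq (hdom l).2

lemma measurable_reward_round : Measurable fun p : FirstAction × SecondAction × Round K =>
    roundReward N (p.2.2.2 p.2.2.winner) p.1 p.2.1 :=
  (measurable_roundReward N).comp (measurable_fst.prodMk (measurable_snd.fst.prodMk
    (measurable_winnerSNR.comp measurable_snd.snd)))

lemma integrable_reward (hS : S.IsFeasible N) : Integrable (reward N S) (pathLaw N) :=
  (integrable_courseSum hS.measurable hS.stops (summable_alive hS)
    (φ := fun a b x => roundReward N (x.2 x.winner) a b) measurable_reward_round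
    (integrable_rewardBound N) fun _ _ _ => abs_roundReward_le N _ _ _).2.1.congr
    (hS.stops.mono fun _ hω => (reward_eq_sum hω).symm)

/-- `E[Y] - lam E[T]` is the sum of the mean gains of the rounds. -/
lemma hasSum_integral_roundGain (hS : S.IsFeasible N) (lam : ℝ) :
    (∀ l, Integrable ((alive N S l).indicator fun ω => roundGain N lam (firstDecision N S ω l)
      (secondDecision N S ω l) (ω l)) (pathLaw N)) ∧
    HasSum (fun l => ∫ ω, (alive N S l).indicator (fun ω => roundGain N lam
        (firstDecision N S ω l) (secondDecision N S ω l) (ω l)) ω ∂(pathLaw N))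
      (∫ ω, reward N S ω ∂(pathLaw N) - lam * ∫ ω, timeCost N S ω ∂(pathLaw N)) := by
  have h := integrable_courseSum hS.measurable hS.stops (summable_alive hS)
    (φ := roundGain N lam) (M := fun x => rewardBound N x + |lam| * (contentionTime N x + N.τd))
    (measurable_reward_round.sub ((measurable_time_round N).const_mul lam))
    ((integrable_rewardBound N).add
      (((integrable_contentionTime N).add (integrable_const _)).const_mul _))
    (fun a b x => (abs_sub _ _).trans (add_le_add (abs_roundReward_le N _ _ _) (by
      rw [abs_mul]
      exact mul_le_mul_of_nonneg_left (abs_time_round_le N a b x) (abs_nonneg _))))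
  refine ⟨h.1, ?_⟩
  have h2 : ∫ ω, ∑ l ∈ Finset.range (stopRound N S ω + 1), roundGain N lam
        (firstDecision N S ω l) (secondDecision N S ω l) (ω l) ∂(pathLaw N)
      = ∫ ω, reward N S ω ∂(pathLaw N) - lam * ∫ ω, timeCost N S ω ∂(pathLaw N) := by
    rw [← integral_const_mul, ← integral_sub (integrable_reward hS)
      (hS.integrable_timeCost.const_mul _)]
    refine integral_congr_ae (hS.stops.mono fun ω hω => ?_)
    simp only [reward_eq_sum hω, timeCost_eq_sum hω, roundGain, Finset.sum_sub_distrib,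
      Finset.mul_sum]
  exact h2 ▸ h.2.2

/-- The mean gain of a round, computed by integrating out the round given the past. -/
lemma integral_alive_roundGain {lam : ℝ} {l : ℕ}
    (h : Integrable ((alive N S l).indicator fun ω => roundGain N lam (firstDecision N S ω l)
      (secondDecision N S ω l) (ω l)) (pathLaw N)) :
    ∫ ω, (alive N S l).indicator (fun ω => roundGain N lam
        (firstDecision N S ω l) (secondDecision N S ω l) (ω l)) ω ∂(pathLaw N)
      = ∫ ω, (alive N S l).indicator (fun ω => ∫ x, roundGain N lam
        (S.first l (history N S ω l) (firstObs N x))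
        (S.second l (history N S ω l) (firstObs N x) (secondObs x)) x ∂(roundLaw N)) ω
          ∂(pathLaw N) := by
  unfold pathLaw at h ⊢
  rw [integral_resample (roundLaw N) l h]
  refine integral_congr_ae (ae_of_all _ fun ω => ?_)
  by_cases hω : ω ∈ alive N S l
  · simp only [Set.indicator_of_mem hω, Set.indicator_of_mem ((update_mem_alive N S ω l _).2 hω),
      firstDecision, secondDecision, history_update N S ω l _ le_rfl, Function.update_self]
  · simp only [Set.indicator_of_notMem hω,
      Set.indicator_of_notMem (fun h => hω ((update_mem_alive N S ω l _).1 h)), integral_zero]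

/-- With the history held fixed, the decisions of round `l` form a rule for a single round, whose
mean gain is at most the difference of the two sides of `BellmanEquation`, that is `0`. -/
lemma integral_reward_le (hS : S.IsFeasible N) {lam : ℝ} (hlam : BellmanEquation N lam) :
    ∫ ω, reward N S ω ∂(pathLaw N) ≤ lam * ∫ ω, timeCost N S ω ∂(pathLaw N) := by
  have h := hasSum_integral_roundGain hS lam
  refine sub_nonpos.1 (h.2.nonpos fun l => ?_)
  rw [integral_alive_roundGain (h.1 l)]
  refine integral_nonpos fun ω => Set.indicator_apply_le' (fun _ => ?_) fun _ => le_rfl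
  refine (integral_roundGain_le N lam
    ((hS.measurable.first l).comp measurable_prodMk_left)
    ((hS.measurable.second l).comp measurable_prodMk_left)).trans ?_
  exact (sub_eq_zero.2 hlam).le

lemma integral_timeCost_pos (hS : S.IsFeasible N) : 0 < ∫ ω, timeCost N S ω ∂(pathLaw N) := by
  have hc := add_pos N.τR_pos N.τC_pos
  have h : ∀ ω, N.τd ≤ timeCost N S ω := fun ω => by
    have h1 : 0 ≤ ∑ l ∈ Finset.range (stopRound N S ω + 1), contentionTime N (ω l) :=
      Finset.sum_nonneg fun l _ => hc.le.trans (le_contentionTime N _)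
    have h2 := Finset.sum_nonneg (s := Finset.range (stopRound N S ω))
      (f := fun l => open Classical in if firstDecision N S ω l = .probe then N.τ₁ else 0)
      fun l _ => by
        split_ifs
        exacts [N.τ₁_pos.le, le_rfl]
    unfold timeCost
    linarith
  have h2 := integral_mono (integrable_const N.τd) hS.integrable_timeCost h
  rw [integral_const, probReal_univ, one_smul] at h2
  exact N.τd_pos.trans_le h2

end Course

/-! ### The strategy RPCA -/

section RPCA

variable (N : Network K) (lam : ℝ)

lemma rpca_isMeasurable : (rpca N lam).IsMeasurable where
  first _ := (measurable_rpca_first N lam).comp measurable_snd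
  second _ := (measurable_rpca_second N lam).comp measurable_snd

variable [NeZero K]

/-- The rounds in which RPCA stops. -/
def rpcaStop : Set (Round K) :=
  {x | (rpca N lam).first 0 Fin.elim0 (firstObs N x) = .transmit ∨
    ((rpca N lam).first 0 Fin.elim0 (firstObs N x) = .probe ∧
      (rpca N lam).second 0 Fin.elim0 (firstObs N x) (secondObs x) = .transmit)}

lemma measurableSet_rpcaStop : MeasurableSet (rpcaStop N lam) := by
  have h1 := (measurable_rpca_first N lam).comp (measurable_firstObs N)
  have h2 := (measurable_rpca_second N lam).comp
    ((measurable_firstObs N).prodMk measurable_secondObs)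
  exact (h1 (MeasurableSet.singleton FirstAction.transmit)).union
    ((h1 (MeasurableSet.singleton FirstAction.probe)).inter
      (h2 (MeasurableSet.singleton SecondAction.transmit)))

variable {N lam}

/-- If RPCA almost never stopped in a round, it would earn nothing there and pay for at least `τR +
τC`. Its mean gain would be at most `-lam * (τR + τC) < 0`, whereas it equals `0` by the optimality
equation. -/
lemma rpcaStop_pos (h0 : 0 < lam) (hlam : BellmanEquation N lam) :
    0 < (roundLaw N).real (rpcaStop N lam) := by
  by_contra hneg
  have hz : (roundLaw N) (rpcaStop N lam) = 0 :=
    (measureReal_eq_zero_iff (by finiteness)).1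
      (le_antisymm (not_lt.1 hneg) measureReal_nonneg)
  have hc := add_pos N.τR_pos N.τC_pos
  have h1 := (measurable_rpca_first N lam).comp (measurable_firstObs N)
  have h2 := (measurable_rpca_second N lam).comp
    ((measurable_firstObs N).prodMk measurable_secondObs)
  have h3 := integral_roundGain_rpca N lam
  rw [hlam, sub_self] at h3
  have h4 := integral_mono_ae (integrable_roundGain N lam h1 h2)
    (integrable_const (-(lam * (N.τR + N.τC)))) (by
      filter_upwards [measure_eq_zero_iff_ae_notMem.1 hz] with x hx
      have h5 : roundReward N (x.2 x.winner) ((rpca N lam).first 0 Fin.elim0 (firstObs N x))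
          ((rpca N lam).second 0 Fin.elim0 (firstObs N x) (secondObs x)) = 0 := by
        simp only [rpcaStop, Set.mem_ofPred_eq] at hx
        cases ha : (rpca N lam).first 0 Fin.elim0 (firstObs N x) <;>
          cases hb : (rpca N lam).second 0 Fin.elim0 (firstObs N x) (secondObs x) <;>
          simp_all [roundReward]
      have h6 := le_contentionTime N x
      have h7 := roundTime_nonneg N ((rpca N lam).first 0 Fin.elim0 (firstObs N x))
          ((rpca N lam).second 0 Fin.elim0 (firstObs N x) (secondObs x))
      simp only [roundGain, Function.comp_apply, h5, zero_sub, neg_le_neg_iff]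
      exact mul_le_mul_of_nonneg_left (by linarith) h0.le)
  rw [integral_const, probReal_univ, one_smul] at h4
  have h8 := mul_pos h0 hc
  simp only [Function.comp_apply] at h4
  linarith

/-- RPCA ignores the past, so its rounds are independent trials with the same positive probability
of stopping. The probability of being alive decays geometrically, which gives both almost sure
stopping and a finite mean time cost. -/
lemma rpca_isFeasible (h0 : 0 < lam) (hlam : BellmanEquation N lam) :
    (rpca N lam).IsFeasible N := by
  have hD := measurableSet_rpcaStop N lam
  have hpos := rpcaStop_pos h0 hlam
  have hends : ∀ᵐ ω ∂(pathLaw N), ∃ k, StopsAt N (rpca N lam) ω k :=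
    -- The decisions of `rpca` use neither the round index nor the history, so stopping in round `k`
    -- is by definition the event `ω k ∈ rpcaStop N lam`.
    ae_exists_mem (roundLaw N) hD hpos
  refine ⟨rpca_isMeasurable N lam, hends, ?_⟩
  have hsum : Summable fun l => (pathLaw N).real (alive N (rpca N lam) l) := by
    have h : ∀ l, (pathLaw N).real (alive N (rpca N lam) l)
        = (1 - (roundLaw N).real (rpcaStop N lam)) ^ l := infinitePi_real_avoid (roundLaw N) hD
    simp_rw [h]
    exact summable_geometric_of_lt_one (sub_nonneg.2 measureReal_le_one) (by linarith)
  exact (integrable_courseSum (rpca_isMeasurable N lam) hends hsum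
    (φ := fun a b x => contentionTime N x + roundTime N a b) (measurable_time_round N)
    ((integrable_contentionTime N).add (integrable_const N.τd)) (abs_time_round_le N)).2.1.congr
    (hends.mono fun _ hω => (timeCost_eq_sum hω).symm)

/-- Whatever the past, each round that RPCA reaches has mean gain exactly `0`, so the series for
`E[Y] - lam * E[T]` has only zero terms. -/
lemma integral_reward_rpca (h0 : 0 < lam) (hlam : BellmanEquation N lam) :
    ∫ ω, reward N (rpca N lam) ω ∂(pathLaw N)
      = lam * ∫ ω, timeCost N (rpca N lam) ω ∂(pathLaw N) := by
  have h := hasSum_integral_roundGain (rpca_isFeasible h0 hlam) lam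
  have hz : ∀ l, ∫ ω, (alive N (rpca N lam) l).indicator (fun ω => roundGain N lam
      (firstDecision N (rpca N lam) ω l) (secondDecision N (rpca N lam) ω l) (ω l)) ω
        ∂(pathLaw N) = 0 := by
    intro l
    rw [integral_alive_roundGain (h.1 l)]
    have h1 := integral_roundGain_rpca N lam
    rw [hlam, sub_self] at h1
    have h2 : ∀ ω : Path K, ∫ x, roundGain N lam
        ((rpca N lam).first l (history N (rpca N lam) ω l) (firstObs N x))
        ((rpca N lam).second l (history N (rpca N lam) ω l) (firstObs N x) (secondObs x)) x
          ∂(roundLaw N) = 0 := fun _ => h1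
    simp [h2]
  have h3 := h.2
  simp only [hz] at h3
  exact sub_eq_zero.1 (h3.unique hasSum_zero)

end RPCA

end VANET

/-! ### The maximal throughput -/

theorem theorem1 {K : ℕ} [NeZero K] (N : VANET.Network K) :
    ∃ lam : ℝ, 0 < lam ∧
      -- `lam` is the maximal average throughput, and the strategy RPCA at the price `lam` attains it
      IsGreatest (VANET.throughput N '' {S | S.IsFeasible N}) lam ∧
      (VANET.rpca N lam).IsFeasible N ∧
      VANET.throughput N (VANET.rpca N lam) = lam ∧
      -- `lam` is determined by the optimality equation
      (∀ μ : ℝ, VANET.BellmanEquation N μ ↔ μ = lam) ∧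
      -- the threshold functions are the conditional expectations, given the winner and its V2V SNR,
      -- of the reward of probing
      (∀ μ : ℝ, MeasureTheory.condExp
          (MeasurableSpace.comap
            (fun x : VANET.Round K => (x.winner, (x.2 x.winner).1)) inferInstance)
          (VANET.roundLaw N)
          (fun x => VANET.probeReward N μ (x.2 x.winner).1 (x.2 x.winner).2.1 (x.2 x.winner).2.2)
        =ᵐ[VANET.roundLaw N] fun x => VANET.W N x.winner (x.2 x.winner).1 μ) ∧
      -- all expectations involved are those of integrable random variables
      (∀ S : VANET.Strategy K, S.IsFeasible N →
        MeasureTheory.Integrable (VANET.reward N S) (VANET.pathLaw N)) ∧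
      (∀ μ : ℝ, MeasureTheory.Integrable (VANET.bellmanReward N μ) (VANET.roundLaw N)) ∧
      (∀ (i : Fin K) (γ μ : ℝ), 0 ≤ γ → MeasureTheory.Integrable
        (fun g : ℝ × ℝ => VANET.probeReward N μ γ g.1 g.2) (VANET.rsuLaw N i)) := by
  obtain ⟨lam, h0, hiff⟩ := VANET.exists_bellmanEquation_iff N
  have hlam : VANET.BellmanEquation N lam := (hiff lam).2 rfl
  have hfeas := VANET.rpca_isFeasible h0 hlam
  have hval : VANET.throughput N (VANET.rpca N lam) = lam := by
    unfold VANET.throughput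
    rw [VANET.integral_reward_rpca h0 hlam]
    exact mul_div_cancel_right₀ _ (VANET.integral_timeCost_pos hfeas).ne'
  refine ⟨lam, h0, ⟨⟨_, hfeas, hval⟩, ?_⟩, hfeas, hval, hiff, VANET.condExp_probeReward N,
    fun S hS => VANET.integrable_reward hS, VANET.integrable_bellmanReward N,
    fun i γ μ hγ => VANET.integrable_probeReward_rsuLaw N i μ hγ⟩
  rintro _ ⟨S, hS, rfl⟩
  exact (div_le_iff₀ (VANET.integral_timeCost_pos hS)).2 (VANET.integral_reward_le hS hlam)
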